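/- Let $n\ge 1$ and let $\mathcal H_1,\dots,\mathcal H_n$ be finite-dimensional complex Hilbert spaces. An entanglement monotone (EM) for $n$-partite pure states is a real-valued function $E$, defined on the unit vectors of all tensor products $\mathcal K_1\otimes\dots\otimes\mathcal K_n$ of finite-dimensional complex Hilbert spaces $\mathcal K_l=\mathbb C^{d_l}$, such that $E\ge 0$, $E(|\psi\rangle)=0$ for every product state $|\psi\rangle$, and, for every state $|\psi\rangle\in\mathcal K_1\otimes\dots\otimes\mathcal K_n$, every $i$ and all finitely many operators $A_k:\mathcal K_i\to\mathcal K_i'$ with $\sum_k A_k^\dagger A_k=I$, $$E(|\psi\rangle)\ \ge\ \sum_{k:\,p_k>0}p_k\,E\!\left(\frac{\tilde A_k|\psi\rangle}{\sqrt{p_k}}\right),\qquad \tilde A_k=I_1\otimes\dots\otimes A_k\otimes\dots\otimes I_n,\quad p_k=\|\tilde A_k|\psi\rangle\|^2,$$ where $A_k$ stands at position $i$. Theorem 1. The values of all EMs determine the orbit of a multipartite pure state under local unitaries: for unit vectors $|\psi\rangle,|\phi\rangle\in\mathcal H_1\otimes\dots\otimes\mathcal H_n$ one has $E(|\psi\rangle)=E(|\phi\rangle)$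 for every entanglement monotone $E$ if and only if $|\phi\rangle=(U_1\otimes\dots\otimes U_n)|\psi\rangle$ for some unitary operators $U_l$ on $\mathcal H_l$. -/

import Mathlib

open scoped Matrix

noncomputable section

/-- The Hilbert space `H_1 ⊗ … ⊗ H_n` with `H_l = ℂ^(d l)`: a vector is the array of its
coefficients `ψ (j_1, …, j_n)` in the product basis, with the Euclidean inner product. -/
abbrev Ket {n : ℕ} (d : Fin n → ℕ) : Type :=
  EuclideanSpace ℂ ((l : Fin n) → Fin (d l))

/-- A pure state is a unit vector. -/
def IsState {n : ℕ} {d : Fin n → ℕ} (ψ : Ket d) : Prop := ‖ψ‖ = 1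

/-- A product vector `v_1 ⊗ … ⊗ v_n`. -/
def IsProductKet {n : ℕ} {d : Fin n → ℕ} (ψ : Ket d) : Prop :=
  ∃ v : (l : Fin n) → Fin (d l) → ℂ, ∀ j, ψ j = ∏ l, v l (j l)

/-- The operator `A_1 ⊗ … ⊗ A_n` applied to a vector. -/
def tensorApply {n : ℕ} {d d' : Fin n → ℕ}
    (A : (l : Fin n) → Matrix (Fin (d' l)) (Fin (d l)) ℂ) (ψ : Ket d) : Ket d' :=
  WithLp.toLp 2 fun j => ∑ k, (∏ l, A l (j l) (k l)) * ψ k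

/-- The matrix with entry `1` at equal positions and `0` elsewhere: for `a = b` (the only case
that matters below) it is the identity matrix. -/
def idMatrix (a b : ℕ) : Matrix (Fin a) (Fin b) ℂ :=
  Matrix.of fun x y => if (x : ℕ) = (y : ℕ) then 1 else 0

/-- `I_1 ⊗ … ⊗ A ⊗ … ⊗ I_n` with `A : H_i → H_i'` at position `i`, applied to a vector; the local
dimensions `d'` after the operation are those before it, except possibly at `i`. -/
def applyAt {n : ℕ} {d d' : Fin n → ℕ} (i : Fin n)
    (A : Matrix (Fin (d' i)) (Fin (d i)) ℂ) (ψ : Ket d) : Ket d' :=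
  tensorApply (Function.update (fun l => idMatrix (d' l) (d l)) i A) ψ

/-- The vector divided by its norm (and `0` for the vector `0`). -/
def normalized {n : ℕ} {d : Fin n → ℕ} (ψ : Ket d) : Ket d :=
  ((‖ψ‖ : ℂ)⁻¹) • ψ

/-- An entanglement monotone for `n`-partite pure states: a function of the states of all
`n`-partite systems with finite-dimensional parts, which is nonnegative, vanishes on product states
and does not increase on average under an operation on one part. Only the values on
unit vectors are constrained or used: an outcome of probability `0` contributes `0`. -/
structure IsEntanglementMonotone {n : ℕ} (E : (d : Fin n → ℕ) → Ket d → ℝ) : Prop where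
  nonneg : ∀ (d : Fin n → ℕ) (ψ : Ket d), IsState ψ → 0 ≤ E d ψ
  product : ∀ (d : Fin n → ℕ) (ψ : Ket d), IsState ψ → IsProductKet ψ → E d ψ = 0
  monotone : ∀ (d d' : Fin n → ℕ) (i : Fin n), (∀ l, l ≠ i → d' l = d l) →
    ∀ (r : ℕ) (A : Fin r → Matrix (Fin (d' i)) (Fin (d i)) ℂ),
      ∑ k, (A k)ᴴ * A k = 1 →
    ∀ ψ : Ket d, IsState ψ →
      ∑ k, ‖(applyAt i (A k) ψ : Ket d')‖ ^ 2 *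
        E d' (normalized (applyAt i (A k) ψ)) ≤ E d ψ

/-- Two vectors lie in the same orbit of the group `U(H_1) × … × U(H_n)` of local unitaries. -/
def LocalUnitaryEquivalent {n : ℕ} {d : Fin n → ℕ} (ψ φ : Ket d) : Prop :=
  ∃ U : (l : Fin n) → Matrix (Fin (d l)) (Fin (d l)) ℂ,
    (∀ l, U l ∈ Matrix.unitaryGroup (Fin (d l)) ℂ) ∧ φ = tensorApply U ψ

end

/-! Let `G_l` be independent complex Gaussian matrices and `K_m(Ψ, χ)` the mean of `|⟨Ψ| G_1 ⊗ … ⊗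
G_n |χ⟩|^(2m)`. With all `G_l`, `l ≠ i`, frozen, the amplitude is linear in `G_i`, hence a Gaussian
variable; its conditional `2m`-th moment is a constant times `‖N‖^(2m)`, where `N` is the
coefficient matrix and the norm is Hilbert-Schmidt. A local operation `A_k` at `i` sends `N` to `N
A_kᵀ`, and `∑ ‖N A_kᵀ‖² = ‖N‖²`. Convexity of `x ↦ x^m` then shows that `K_m(Ψ, ·)` does not
decrease on average (`overlapMoment_le_sum`). A constant minus `K_m(Ψ, ·)`, reset to `0` on product
states, is therefore a monotone. Infinite arrays supply the `G_l` of all local dimensions at once.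

If all these monotones agree on non-product states `ψ`, `φ`, then `K_m(Ψ, ψ) = K_m(Ψ, φ)` for all
`Ψ`, so `K_m(ψ, ψ) + K_m(φ, φ) = K_m(ψ, φ) + K_m(φ, ψ)`. Now fix the matrices `M` and average `|⟨U
a| M |V b⟩|^(2m)` over local unitaries `U`, `V`. By polar decomposition and Haar invariance this is
a positive semidefinite kernel in `a`, `b` (`unitaryAverage_eq_inner`), and its Gaussian mean over
`M` is `K_m(a, b)`. So the nonnegative squared distance between `ψ` and `φ` for this kernel has mean
zero; by continuity and full support it vanishes for every `M`, in particular for `M = 1`.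

At `M = 1`, inequivalence of `ψ` and `φ` bounds the cross terms by `c^(2m)` with `c < 1`, while the
term of `ψ` with itself is at least `τ t^(2m)` for some `t > c`, `τ > 0`. Large `m` gives a
contradiction.

Conversely, a unitary and its inverse are both deterministic local operations, so monotones are
constant on orbits. -/

noncomputable section

/-! ### Gaussian arrays: moments of linear forms and full support. -/

open MeasureTheory ProbabilityTheory ENNReal in
/-- The law of an infinite array of independent standard complex Gaussian variables. -/
def gaussianArray : Measure (ℕ × ℕ → ℂ) := Measure.infinitePi fun _ => stdGaussian ℂ

namespace gaussianArray

open MeasureTheory ProbabilityTheory ENNReal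

instance : IsProbabilityMeasure gaussianArray := by
  unfold gaussianArray; infer_instance

/-- The absolute moments of the standard complex Gaussian variable. -/
def moment (m : ℕ) : ℝ≥0∞ := ∫⁻ z, ‖z‖ₑ ^ (2 * m) ∂(stdGaussian ℂ)

theorem moment_ne_top (m : ℕ) : moment m ≠ ∞ := by
  have h := IsGaussian.memLp_id (stdGaussian ℂ) ((2 * m : ℕ) : ℝ≥0∞) (natCast_ne_top _)
  rcases Nat.eq_zero_or_pos m with rfl | hm
  · simp [moment]
  · have h2 := lintegral_rpow_enorm_lt_top_of_eLpNorm_lt_top (by simpa using hm.ne')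
      (natCast_ne_top _) h.2
    simpa [moment, ← ENNReal.rpow_natCast] using h2.ne

theorem charFun_map_mul_right (μ : Measure ℂ) (a t : ℂ) :
    charFun (μ.map (fun z => z * a)) t = charFun μ (t * star a) := by
  rw [charFun_apply, charFun_apply, integral_map (by fun_prop) (by fun_prop)]
  congr 1 with z
  congr 2
  simp only [Complex.inner]
  congr 2
  simp
  ring

/-- Characteristic functions of independent terms multiply, and each is the exponential of a
quadratic form, so only the Hilbert-Schmidt norm of `N` survives. -/
theorem map_sum_mul {D d : ℕ} (N : Matrix (Fin D) (Fin d) ℂ) :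
    gaussianArray.map (fun g => ∑ p : Fin D × Fin d, g (p.1, p.2) * N p.1 p.2) =
      (stdGaussian ℂ).map (fun z : ℂ => z * ((√(∑ p : Fin D × Fin d, ‖N p.1 p.2‖ ^ 2) : ℝ) : ℂ)) := by
  apply Measure.ext_of_charFun
  have hind : iIndepFun (fun (p : Fin D × Fin d) (g : ℕ × ℕ → ℂ) => g (p.1, p.2) * N p.1 p.2)
      gaussianArray := by
    have h := iIndepFun_infinitePi (P := fun _ : ℕ × ℕ => stdGaussian ℂ)
      (X := fun _ z => z) (by fun_prop)
    have h2 := h.precomp (g := fun p : Fin D × Fin d => ((p.1 : ℕ), (p.2 : ℕ)))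
      (by rintro ⟨a, b⟩ ⟨c, d⟩ h; simp [Fin.ext_iff] at h ⊢; exact h)
    exact h2.comp (fun p z => z * N p.1 p.2) (by fun_prop)
  rw [hind.charFun_map_fun_sum_eq_prod
    (fun p => Measurable.aemeasurable (by fun_prop))]
  ext t
  rw [Finset.prod_apply, charFun_map_mul_right, charFun_stdGaussian]
  have h1 : ∀ p : Fin D × Fin d, charFun (gaussianArray.map
      (fun g : ℕ × ℕ → ℂ => g (p.1, p.2) * N p.1 p.2)) t =
      Complex.exp (-(‖t * star (N p.1 p.2)‖ : ℂ) ^ 2 / 2) := by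
    intro p
    have : (fun g : ℕ × ℕ → ℂ => g (p.1, p.2) * N p.1 p.2) =
        (fun z => z * N p.1 p.2) ∘ (fun g => g (p.1, p.2)) := rfl
    rw [this, ← Measure.map_map (by fun_prop) (by fun_prop)]
    have h3 : gaussianArray.map (fun g => g ((p.1 : ℕ), (p.2 : ℕ))) = stdGaussian ℂ := by
      exact Measure.infinitePi_map_eval (fun _ => stdGaussian ℂ) _
    rw [h3, charFun_map_mul_right, charFun_stdGaussian]
  simp_rw [h1]
  rw [← Complex.exp_sum]
  congr 1
  have h0 : 0 ≤ ∑ p : Fin D × Fin d, ‖N p.1 p.2‖ ^ 2 := by positivity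
  simp only [norm_mul, norm_star, mul_pow, Complex.ofReal_mul, Complex.norm_real, Real.norm_eq_abs,
    abs_of_nonneg (Real.sqrt_nonneg _)]
  rw [← Complex.ofReal_pow (√_), Real.sq_sqrt h0, ← Finset.sum_div, Finset.sum_neg_distrib,
    ← Finset.mul_sum]
  push_cast
  rfl

theorem lintegral_enorm_sum_mul_pow {D d : ℕ} (m : ℕ) (N : Matrix (Fin D) (Fin d) ℂ) :
    ∫⁻ g, ‖∑ u : Fin D, ∑ a : Fin d, g (u, a) * N u a‖ₑ ^ (2 * m) ∂gaussianArray =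
      moment m * ENNReal.ofReal ((∑ u, ∑ a, ‖N u a‖ ^ 2) ^ m) := by
  have h0 : 0 ≤ ∑ p : Fin D × Fin d, ‖N p.1 p.2‖ ^ 2 := by positivity
  have h1 : ∫⁻ g, ‖∑ u : Fin D, ∑ a : Fin d, g (u, a) * N u a‖ₑ ^ (2 * m) ∂gaussianArray =
      ∫⁻ z, ‖z‖ₑ ^ (2 * m)
        ∂(gaussianArray.map (fun g => ∑ p : Fin D × Fin d, g (p.1, p.2) * N p.1 p.2)) := by
    rw [lintegral_map (by fun_prop) (by fun_prop)]
    simp_rw [Fintype.sum_prod_type]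
  rw [h1, map_sum_mul, lintegral_map (by fun_prop) (by fun_prop), ← Fintype.sum_prod_type']
  simp_rw [enorm_mul, mul_pow]
  rw [lintegral_mul_const _ (by fun_prop), moment]
  congr 1
  rw [← ofReal_norm, ← ENNReal.ofReal_pow (norm_nonneg _), pow_mul]
  congr 2
  simp only [Complex.norm_real, Real.norm_eq_abs, sq_abs]
  exact Real.sq_sqrt h0

instance : (stdGaussian ℂ).IsOpenPosMeasure := by
  have h1 : (gaussianReal 0 1).IsOpenPosMeasure :=
    (gaussianReal_absolutelyContinuous' 0 one_ne_zero).isOpenPosMeasure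
  unfold stdGaussian
  refine Continuous.isOpenPosMeasure_map (by fun_prop) ?_
  intro z
  exact ⟨fun i => (stdOrthonormalBasis ℝ ℂ).repr z i, (stdOrthonormalBasis ℝ ℂ).sum_repr z⟩

/-- Only finitely many entries are constrained, so the box has a finite product of positive ball
measures as a lower bound. -/
theorem measure_setOf_norm_sub_lt_pos {D d : ℕ} (N : Matrix (Fin D) (Fin d) ℂ) {ε : ℝ}
    (hε : 0 < ε) :
    0 < gaussianArray {g | ∀ (u : Fin D) (a : Fin d), ‖g (u, a) - N u a‖ < ε} := by
  let c : ℕ × ℕ → ℂ := fun q =>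
    if h : q.1 < D ∧ q.2 < d then N ⟨q.1, h.1⟩ ⟨q.2, h.2⟩ else 0
  have h : Set.pi ((Finset.range D ×ˢ Finset.range d : Finset (ℕ × ℕ)) : Set (ℕ × ℕ))
      (fun q => Metric.ball (c q) ε) ⊆
      {g | ∀ (u : Fin D) (a : Fin d), ‖g (u, a) - N u a‖ < ε} := by
    intro g hg u a
    have := hg (u, a) (by simp)
    simpa [c, dist_eq_norm] using this
  refine lt_of_lt_of_le ?_ (measure_mono h)
  unfold gaussianArray
  rw [Measure.infinitePi_pi _ (fun _ _ => measurableSet_ball)]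
  exact pos_iff_ne_zero.2 <| Finset.prod_ne_zero_iff.2 fun q _ =>
    (Metric.isOpen_ball.measure_pos _ (by simpa using hε)).ne'

end gaussianArray

end

/-! ### Tensor products of operators, amplitudes and outcome probabilities. -/

noncomputable section

section TensorApply

variable {n : ℕ}

theorem tensorApply_apply {d d' : Fin n → ℕ}
    (A : (l : Fin n) → Matrix (Fin (d' l)) (Fin (d l)) ℂ) (ψ : Ket d) (j : (l : Fin n) → Fin (d' l)) :
    tensorApply A ψ j = ∑ k, (∏ l, A l (j l) (k l)) * ψ k := rfl

theorem tensorApply_tensorApply {d d' d'' : Fin n → ℕ}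
    (B : (l : Fin n) → Matrix (Fin (d'' l)) (Fin (d' l)) ℂ)
    (A : (l : Fin n) → Matrix (Fin (d' l)) (Fin (d l)) ℂ) (ψ : Ket d) :
    tensorApply B (tensorApply A ψ) = tensorApply (fun l => B l * A l) ψ := by
  ext j
  simp only [tensorApply_apply, Matrix.mul_apply, Finset.mul_sum]
  rw [Finset.sum_comm]
  refine Finset.sum_congr rfl fun k _ => ?_
  rw [Fintype.prod_sum, Finset.sum_mul]
  refine Finset.sum_congr rfl fun x _ => ?_
  rw [Finset.prod_mul_distrib, mul_assoc]

theorem tensorApply_one {d : Fin n → ℕ} (ψ : Ket d) :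
    tensorApply (fun _ => 1) ψ = ψ := by
  ext j
  rw [tensorApply_apply, Finset.sum_eq_single j]
  · simp
  · intro k _ hk
    obtain ⟨l, hl⟩ := Function.ne_iff.1 hk
    have h : (1 : Matrix (Fin (d l)) (Fin (d l)) ℂ) (j l) (k l) = 0 := Matrix.one_apply_ne hl.symm
    rw [Finset.prod_eq_zero (Finset.mem_univ l) h, zero_mul]
  · simp

theorem tensorApply_smul {d d' : Fin n → ℕ}
    (A : (l : Fin n) → Matrix (Fin (d' l)) (Fin (d l)) ℂ) (c : ℂ) (ψ : Ket d) :
    tensorApply A (c • ψ) = c • tensorApply A ψ := by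
  ext j
  simp only [tensorApply_apply, PiLp.smul_apply, smul_eq_mul, Finset.mul_sum]
  exact Finset.sum_congr rfl fun k _ => by ring

theorem inner_ket {d : Fin n → ℕ} (φ ψ : Ket d) : inner ℂ φ ψ = ∑ j, star (φ j) * ψ j := by
  simp [PiLp.inner_apply, mul_comm]

theorem inner_tensorApply_left {d d' : Fin n → ℕ}
    (A : (l : Fin n) → Matrix (Fin (d' l)) (Fin (d l)) ℂ) (ψ : Ket d) (φ : Ket d') :
    inner ℂ (tensorApply A ψ) φ = inner ℂ ψ (tensorApply (fun l => (A l)ᴴ) φ) := by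
  simp only [inner_ket, tensorApply_apply, star_sum, Finset.sum_mul, Finset.mul_sum, star_mul',
    star_prod, Matrix.conjTranspose_apply]
  rw [Finset.sum_comm]
  exact Finset.sum_congr rfl fun k _ => Finset.sum_congr rfl fun x _ => by ring

/-- The matrix element `⟨Ψ| M_1 ⊗ … ⊗ M_n |χ⟩` as a multilinear function of the `M_l`. -/
def amplitude {D d : Fin n → ℕ} (Ψ : Ket D) (χ : Ket d) :
    MultilinearMap ℂ (fun l : Fin n => Matrix (Fin (D l)) (Fin (d l)) ℂ) ℂ :=
  ∑ j, ∑ k, (star (Ψ j) * χ k) • (MultilinearMap.mkPiAlgebra ℂ (Fin n) ℂ).compLinearMap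
    fun l => Matrix.entryLinearMap ℂ ℂ (j l) (k l)

theorem amplitude_apply {D d : Fin n → ℕ} (Ψ : Ket D) (χ : Ket d)
    (M : (l : Fin n) → Matrix (Fin (D l)) (Fin (d l)) ℂ) :
    amplitude Ψ χ M = inner ℂ Ψ (tensorApply M χ) := by
  simp only [amplitude, inner_ket, tensorApply_apply, Finset.mul_sum]
  simp only [_root_.sum_apply, _root_.smul_apply,
    MultilinearMap.compLinearMap_apply, MultilinearMap.mkPiAlgebra_apply, smul_eq_mul,
    Matrix.entryLinearMap_apply]
  exact Finset.sum_congr rfl fun k _ => Finset.sum_congr rfl fun x _ => by ring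

theorem amplitude_smul_right {D d : Fin n → ℕ} (Ψ : Ket D) (c : ℂ) (χ : Ket d)
    (M : (l : Fin n) → Matrix (Fin (D l)) (Fin (d l)) ℂ) :
    amplitude Ψ (c • χ) M = c * amplitude Ψ χ M := by
  rw [amplitude_apply, amplitude_apply, tensorApply_smul, inner_smul_right]

theorem idMatrix_self (a : ℕ) : idMatrix a a = 1 := by
  ext x y
  simp [idMatrix, Matrix.one_apply, Fin.ext_iff]

theorem conjTranspose_mul_idMatrix {a b : ℕ} (h : a = b) :
    (idMatrix a b)ᴴ * idMatrix a b = 1 := by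
  subst h
  simp [idMatrix_self]

/-- Expresses the outcome probability linearly in `Aᴴ * A`, so that the completeness relation can be
summed inside the slot. -/
theorem norm_sq_applyAt {d d' : Fin n → ℕ} {i : Fin n} (hd : ∀ l, l ≠ i → d' l = d l)
    (A : Matrix (Fin (d' i)) (Fin (d i)) ℂ) (ψ : Ket d) :
    ((‖(applyAt i A ψ : Ket d')‖ ^ 2 : ℝ) : ℂ) =
      amplitude ψ ψ (Function.update (fun _ => 1) i (Aᴴ * A)) := by
  rw [amplitude_apply]
  have h := inner_self_eq_norm_sq_to_K (𝕜 := ℂ) (applyAt i A ψ : Ket d')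
  rw [Complex.ofReal_pow]
  refine h.symm.trans ?_
  unfold applyAt
  rw [inner_tensorApply_left, tensorApply_tensorApply]
  congr 2
  funext l
  rcases eq_or_ne l i with rfl | hl
  · simp
  · simp [hl, conjTranspose_mul_idMatrix (hd l hl)]

theorem sum_norm_sq_applyAt {d d' : Fin n → ℕ} {i : Fin n} (hd : ∀ l, l ≠ i → d' l = d l)
    {r : ℕ} (A : Fin r → Matrix (Fin (d' i)) (Fin (d i)) ℂ) (hA : ∑ k, (A k)ᴴ * A k = 1)
    (ψ : Ket d) : ∑ k, ‖(applyAt i (A k) ψ : Ket d')‖ ^ 2 = ‖ψ‖ ^ 2 := by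
  apply Complex.ofReal_injective
  rw [Complex.ofReal_sum]
  simp_rw [norm_sq_applyAt hd]
  rw [← MultilinearMap.map_update_sum, hA, amplitude_apply]
  rw [show Function.update (fun l : Fin n => (1 : Matrix (Fin (d l)) (Fin (d l)) ℂ)) i 1 =
    fun _ => 1 from Function.update_eq_self i _, tensorApply_one,
    inner_self_eq_norm_sq_to_K (𝕜 := ℂ)]
  push_cast
  rfl

theorem smul_normalized {d : Fin n → ℕ} (ψ : Ket d) : (‖ψ‖ : ℂ) • normalized ψ = ψ := by
  rcases eq_or_ne ψ 0 with rfl | h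
  · simp
  · rw [normalized, smul_smul, mul_inv_cancel₀ (by simpa using h), one_smul]

theorem isState_normalized {d : Fin n → ℕ} {ψ : Ket d} (h : ψ ≠ 0) : IsState (normalized ψ) := by
  have h' : ‖ψ‖ ≠ 0 := norm_ne_zero_iff.2 h
  simp [IsState, normalized, norm_smul, h']

theorem normalized_of_isState {d : Fin n → ℕ} {ψ : Ket d} (h : IsState ψ) : normalized ψ = ψ := by
  have h' : ‖ψ‖ = 1 := h
  simp [normalized, h']

end TensorApply

/-! ### Hilbert-Schmidt norms and coefficient matrices of linear functionals. -/

section FrobeniusSq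

variable {D d d' : ℕ}

/-- The square of the Hilbert-Schmidt norm. -/
def frobeniusSq (N : Matrix (Fin D) (Fin d) ℂ) : ℝ := ∑ u, ∑ a, ‖N u a‖ ^ 2

theorem frobeniusSq_nonneg (N : Matrix (Fin D) (Fin d) ℂ) : 0 ≤ frobeniusSq N := by
  unfold frobeniusSq; positivity

theorem frobeniusSq_transpose (N : Matrix (Fin D) (Fin d) ℂ) :
    frobeniusSq Nᵀ = frobeniusSq N := Finset.sum_comm

theorem ofReal_frobeniusSq (N : Matrix (Fin D) (Fin d) ℂ) :
    (frobeniusSq N : ℂ) = (N * Nᴴ).trace := by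
  simp [frobeniusSq, Matrix.trace, Matrix.mul_apply, Complex.mul_conj, Complex.normSq_eq_norm_sq]

/-- In `Tr (N (A_kᴴ A_k)ᵀ Nᴴ)` the sum over `k` acts only on the middle factor, where it gives the
identity. -/
theorem sum_frobeniusSq_mul_transpose {r : ℕ} (A : Fin r → Matrix (Fin d') (Fin d) ℂ)
    (hA : ∑ k, (A k)ᴴ * A k = 1) (N : Matrix (Fin D) (Fin d) ℂ) :
    ∑ k, frobeniusSq (N * (A k)ᵀ) = frobeniusSq N := by
  apply Complex.ofReal_injective
  rw [Complex.ofReal_sum]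
  simp_rw [ofReal_frobeniusSq]
  rw [← Matrix.trace_sum]
  congr 1
  have h : ∀ k, N * (A k)ᵀ * (N * (A k)ᵀ)ᴴ = N * ((A k)ᴴ * A k)ᵀ * Nᴴ := by
    intro k
    rw [Matrix.conjTranspose_mul, Matrix.transpose_mul]
    simp only [Matrix.mul_assoc]
    rfl
  simp_rw [h]
  rw [← Matrix.sum_mul, ← Matrix.mul_sum, ← Matrix.transpose_sum, hA]
  simp

theorem frobeniusSq_mul_transpose {V : Matrix (Fin d') (Fin d) ℂ} (hV : Vᴴ * V = 1)
    (N : Matrix (Fin D) (Fin d) ℂ) : frobeniusSq (N * Vᵀ) = frobeniusSq N := by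
  simpa using sum_frobeniusSq_mul_transpose (fun _ : Fin 1 => V) (by simpa using hV) N

theorem frobeniusSq_transpose_mul {U : Matrix (Fin D) (Fin D) ℂ} (hU : U * Uᴴ = 1)
    (N : Matrix (Fin D) (Fin d) ℂ) : frobeniusSq (Uᵀ * N) = frobeniusSq N := by
  rw [← frobeniusSq_transpose, Matrix.transpose_mul, ← frobeniusSq_transpose N]
  refine frobeniusSq_mul_transpose (V := Uᵀ) ?_ Nᵀ
  have := congrArg Matrix.transpose hU
  rwa [Matrix.transpose_mul, Matrix.transpose_one] at this

/-- The matrix of coefficients of a linear functional on matrices. -/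
def coefficients (L : Matrix (Fin D) (Fin d) ℂ →ₗ[ℂ] ℂ) : Matrix (Fin D) (Fin d) ℂ :=
  Matrix.of fun u a => L (Matrix.single u a 1)

theorem apply_eq_sum_coefficients (L : Matrix (Fin D) (Fin d) ℂ →ₗ[ℂ] ℂ)
    (X : Matrix (Fin D) (Fin d) ℂ) : L X = ∑ u, ∑ a, X u a * coefficients L u a := by
  conv_lhs => rw [Matrix.matrix_eq_sum_single X]
  simp only [map_sum, coefficients, Matrix.of_apply]
  refine Finset.sum_congr rfl fun u _ => Finset.sum_congr rfl fun a _ => ?_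
  rw [← smul_eq_mul, ← map_smul, Matrix.smul_single, smul_eq_mul, mul_one]

theorem coefficients_eq_mul_transpose {L : Matrix (Fin D) (Fin d) ℂ →ₗ[ℂ] ℂ}
    {L' : Matrix (Fin D) (Fin d') ℂ →ₗ[ℂ] ℂ} {A : Matrix (Fin d') (Fin d) ℂ}
    (h : ∀ X, L' X = L (X * A)) : coefficients L' = coefficients L * Aᵀ := by
  ext u a
  rw [coefficients, Matrix.of_apply, h, apply_eq_sum_coefficients, Matrix.mul_apply,
    Finset.sum_eq_single u]
  · refine Finset.sum_congr rfl fun b _ => ?_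
    rw [Matrix.single_mul_apply_same, one_mul, mul_comm, Matrix.transpose_apply]
  · intro w _ hw
    exact Finset.sum_eq_zero fun b _ => by
      rw [Matrix.single_mul_apply_of_ne _ _ _ _ _ hw, zero_mul]
  · simp

theorem coefficients_eq_transpose_mul {L L' : Matrix (Fin D) (Fin d) ℂ →ₗ[ℂ] ℂ}
    {U : Matrix (Fin D) (Fin D) ℂ} (h : ∀ X, L' X = L (U * X)) :
    coefficients L' = Uᵀ * coefficients L := by
  ext u a
  rw [coefficients, Matrix.of_apply, h, apply_eq_sum_coefficients, Matrix.mul_apply,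
    Finset.sum_comm, Finset.sum_eq_single a]
  · refine Finset.sum_congr rfl fun b _ => ?_
    rw [Matrix.mul_single_apply_same, mul_one, Matrix.transpose_apply]
  · intro w _ hw
    exact Finset.sum_eq_zero fun b _ => by
      rw [Matrix.mul_single_apply_of_ne _ _ _ _ _ hw, zero_mul]
  · simp

end FrobeniusSq

end

/-! ### Gaussian overlap moments: growth under local operations and unitary invariance. -/

noncomputable section

open MeasureTheory ProbabilityTheory ENNReal

variable {n : ℕ}

/-- The upper left corners of `n` infinite arrays. -/
def truncate (D d : Fin n → ℕ) (G : Fin n → ℕ × ℕ → ℂ) :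
    (l : Fin n) → Matrix (Fin (D l)) (Fin (d l)) ℂ :=
  fun l => Matrix.of fun u a => G l (u, a)

theorem truncate_update (D d : Fin n → ℕ) (G : Fin n → ℕ × ℕ → ℂ) (i : Fin n) (g : ℕ × ℕ → ℂ) :
    truncate D d (Function.update G i g) =
      Function.update (truncate D d G) i (Matrix.of fun u a => g (u, a)) := by
  funext l
  rcases eq_or_ne l i with rfl | h
  · simp [truncate]
  · simp [truncate, h]

theorem continuous_truncate (D d : Fin n → ℕ) :
    Continuous (truncate D d) := by
  refine continuous_pi fun l => continuous_matrix fun u a => ?_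
  simp only [truncate, Matrix.of_apply]
  fun_prop

theorem continuous_amplitude {D d : Fin n → ℕ} (Ψ : Ket D) (χ : Ket d) :
    Continuous (amplitude Ψ χ) := by
  simp_rw [funext (amplitude_apply Ψ χ), inner_ket, tensorApply_apply]
  fun_prop

/-- The Gaussian average of `|⟨Ψ| G_1 ⊗ … ⊗ G_n |χ⟩|^(2m)`. -/
def overlapMoment (m : ℕ) {D d : Fin n → ℕ} (Ψ : Ket D) (χ : Ket d) : ℝ≥0∞ :=
  ∫⁻ G, ‖amplitude Ψ χ (truncate D d G)‖ₑ ^ (2 * m) ∂Measure.pi fun _ : Fin n => gaussianArray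

theorem measurable_enorm_amplitude_pow (m : ℕ) {D d : Fin n → ℕ} (Ψ : Ket D) (χ : Ket d) :
    Measurable fun G => ‖amplitude Ψ χ (truncate D d G)‖ₑ ^ (2 * m) := by
  have := ((continuous_amplitude Ψ χ).comp (continuous_truncate D d)).measurable
  exact (this.enorm).pow_const _

/-- The matrix of coefficients of the amplitude as a function of the operator at position `i`. -/
def slotCoefficients {D d : Fin n → ℕ} (Ψ : Ket D) (χ : Ket d) (i : Fin n)
    (M : (l : Fin n) → Matrix (Fin (D l)) (Fin (d l)) ℂ) : Matrix (Fin (D i)) (Fin (d i)) ℂ :=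
  coefficients ((amplitude Ψ χ).toLinearMap M i)

/-- Conditioning on all arrays but the `i`-th leaves a linear form in one Gaussian array. -/
theorem lmarginal_enorm_amplitude_pow (m : ℕ) {D d : Fin n → ℕ} (Ψ : Ket D) (χ : Ket d)
    (i : Fin n) (G : Fin n → ℕ × ℕ → ℂ) :
    ∫⁻ g, ‖amplitude Ψ χ (truncate D d (Function.update G i g))‖ₑ ^ (2 * m) ∂gaussianArray =
      gaussianArray.moment m *
        ENNReal.ofReal (frobeniusSq (slotCoefficients Ψ χ i (truncate D d G)) ^ m) := by
  rw [frobeniusSq, ← gaussianArray.lintegral_enorm_sum_mul_pow]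
  refine lintegral_congr fun g => ?_
  rw [truncate_update, ← MultilinearMap.toLinearMap_apply, apply_eq_sum_coefficients]
  rfl

theorem amplitude_applyAt {D d d' : Fin n → ℕ} {i : Fin n} (hd : ∀ l, l ≠ i → d' l = d l)
    (A : Matrix (Fin (d' i)) (Fin (d i)) ℂ) (Ψ : Ket D) (χ : Ket d) (G : Fin n → ℕ × ℕ → ℂ)
    (X : Matrix (Fin (D i)) (Fin (d' i)) ℂ) :
    amplitude Ψ (applyAt i A χ : Ket d') (Function.update (truncate D d' G) i X) =
      amplitude Ψ χ (Function.update (truncate D d G) i (X * A)) := by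
  rw [amplitude_apply, amplitude_apply, applyAt, tensorApply_tensorApply]
  congr 2
  funext l
  rcases eq_or_ne l i with rfl | hl
  · simp
  · simp only [ne_eq, hl, not_false_eq_true, Function.update_of_ne]
    ext u a
    have ha : (a : ℕ) < d' l := by rw [hd l hl]; exact a.2
    rw [Matrix.mul_apply, Finset.sum_eq_single ⟨a, ha⟩]
    · simp [truncate, idMatrix]
    · intro b _ hb
      have : (b : ℕ) ≠ a := fun h => hb (Fin.ext h)
      simp [idMatrix, this]
    · simp

theorem slotCoefficients_applyAt {D d d' : Fin n → ℕ} {i : Fin n} (hd : ∀ l, l ≠ i → d' l = d l)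
    (A : Matrix (Fin (d' i)) (Fin (d i)) ℂ) (Ψ : Ket D) (χ : Ket d) (G : Fin n → ℕ × ℕ → ℂ) :
    slotCoefficients Ψ (applyAt i A χ : Ket d') i (truncate D d' G) =
      slotCoefficients Ψ χ i (truncate D d G) * Aᵀ :=
  coefficients_eq_mul_transpose fun X => amplitude_applyAt hd A Ψ χ G X

theorem frobeniusSq_slotCoefficients_smul {D d : Fin n → ℕ} (Ψ : Ket D) (c : ℂ) (χ : Ket d)
    (i : Fin n) (M : (l : Fin n) → Matrix (Fin (D l)) (Fin (d l)) ℂ) :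
    frobeniusSq (slotCoefficients Ψ (c • χ) i M) =
      ‖c‖ ^ 2 * frobeniusSq (slotCoefficients Ψ χ i M) := by
  simp [frobeniusSq, slotCoefficients, coefficients, amplitude_smul_right, mul_pow,
    Finset.mul_sum]

/-- Both sides are compared after integrating the `i`-th array only: there the claim is Jensen's
inequality for `x ↦ x^m` with the outcome probabilities as weights. -/
theorem overlapMoment_le_sum (m : ℕ) {D d d' : Fin n → ℕ} {i : Fin n}
    (hd : ∀ l, l ≠ i → d' l = d l) {r : ℕ} (A : Fin r → Matrix (Fin (d' i)) (Fin (d i)) ℂ)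
    (hA : ∑ k, (A k)ᴴ * A k = 1) (Ψ : Ket D) {χ : Ket d} (hχ : IsState χ) :
    overlapMoment m Ψ χ ≤ ∑ k, ENNReal.ofReal (‖(applyAt i (A k) χ : Ket d')‖ ^ 2) *
      overlapMoment m Ψ (normalized (applyAt i (A k) χ : Ket d')) := by
  have hmeas (k : Fin r) := measurable_enorm_amplitude_pow m Ψ
    (normalized (applyAt i (A k) χ : Ket d'))
  have hp : ∑ k, ‖(applyAt i (A k) χ : Ket d')‖ ^ 2 = 1 := by
    rw [sum_norm_sq_applyAt hd A hA, show ‖χ‖ = 1 from hχ, one_pow]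
  unfold overlapMoment
  simp_rw [← lintegral_const_mul _ (hmeas _)]
  rw [← lintegral_finsetSum _ fun k _ => (hmeas k).const_mul _]
  refine lintegral_le_of_lmarginal_le {i} (measurable_enorm_amplitude_pow m Ψ χ)
    (Finset.measurable_sum _ fun k _ => (hmeas k).const_mul _) ?_
  rw [lmarginal_singleton, lmarginal_singleton]
  intro G
  dsimp only
  have hmeas' (k : Fin r) : Measurable fun g => ‖amplitude Ψ (normalized
      (applyAt i (A k) χ : Ket d')) (truncate D d' (Function.update G i g))‖ₑ ^ (2 * m) :=
    (hmeas k).comp (measurable_update G)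
  rw [lintegral_finsetSum _ fun k _ => (hmeas' k).const_mul _]
  rw [lmarginal_enorm_amplitude_pow, Finset.sum_congr rfl fun k _ => (lintegral_const_mul
    (ENNReal.ofReal (‖(applyAt i (A k) χ : Ket d')‖ ^ 2)) (hmeas' k)).trans
      (congrArg _ (lmarginal_enorm_amplitude_pow m Ψ _ i G))]
  -- Each outcome vector is its norm times its normalization, so the factor `p_k` comes out of the
  -- squared norm of its coefficients.
  have hs : frobeniusSq (slotCoefficients Ψ χ i (truncate D d G)) =
      ∑ k, ‖(applyAt i (A k) χ : Ket d')‖ ^ 2 * frobeniusSq (slotCoefficients Ψ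
        (normalized (applyAt i (A k) χ : Ket d')) i (truncate D d' G)) := by
    rw [← sum_frobeniusSq_mul_transpose A hA]
    refine Finset.sum_congr rfl fun k _ => ?_
    rw [← slotCoefficients_applyAt hd]
    conv_lhs => rw [← smul_normalized (applyAt i (A k) χ : Ket d')]
    rw [frobeniusSq_slotCoefficients_smul]
    simp
  calc _ ≤ gaussianArray.moment m * ENNReal.ofReal (∑ k, ‖(applyAt i (A k) χ : Ket d')‖ ^ 2 *
        frobeniusSq (slotCoefficients Ψ
          (normalized (applyAt i (A k) χ : Ket d')) i (truncate D d' G)) ^ m) := by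
        gcongr
        rw [hs]
        exact Real.pow_arith_mean_le_arith_mean_pow _ _ _ (fun _ _ => by positivity) hp
          (fun _ _ => frobeniusSq_nonneg _) m
    _ = _ := by
        rw [ENNReal.ofReal_sum_of_nonneg fun k _ =>
          mul_nonneg (by positivity) (pow_nonneg (frobeniusSq_nonneg _) _), Finset.mul_sum]
        refine Finset.sum_congr rfl fun k _ => ?_
        rw [ENNReal.ofReal_mul (by positivity)]
        ring

theorem amplitude_tensorApply {D d : Fin n → ℕ} (U : (l : Fin n) → Matrix (Fin (D l)) (Fin (D l)) ℂ)
    (V : (l : Fin n) → Matrix (Fin (d l)) (Fin (d l)) ℂ) (Ψ : Ket D) (χ : Ket d)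
    (M : (l : Fin n) → Matrix (Fin (D l)) (Fin (d l)) ℂ) :
    amplitude (tensorApply U Ψ) (tensorApply V χ) M =
      amplitude Ψ χ (fun l => (U l)ᴴ * (M l * V l)) := by
  rw [amplitude_apply, amplitude_apply, inner_tensorApply_left, tensorApply_tensorApply,
    tensorApply_tensorApply]
  simp only [Matrix.mul_assoc]

theorem slotCoefficients_tensorApply_update {D d : Fin n → ℕ} (i : Fin n)
    (U : Matrix (Fin (D i)) (Fin (D i)) ℂ) (V : Matrix (Fin (d i)) (Fin (d i)) ℂ)
    (Ψ : Ket D) (χ : Ket d) (M : (l : Fin n) → Matrix (Fin (D l)) (Fin (d l)) ℂ) :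
    slotCoefficients (tensorApply (Function.update (fun _ => 1) i U) Ψ)
      (tensorApply (Function.update (fun _ => 1) i V) χ) i M =
      (Uᴴ)ᵀ * slotCoefficients Ψ χ i M * Vᵀ := by
  let L : Matrix (Fin (D i)) (Fin (d i)) ℂ →ₗ[ℂ] ℂ := (amplitude Ψ χ).toLinearMap M i
  let L' : Matrix (Fin (D i)) (Fin (d i)) ℂ →ₗ[ℂ] ℂ := L ∘ₗ mulLeftLinearMap (Fin (d i)) ℂ Uᴴ
  have h2 : coefficients L' = (Uᴴ)ᵀ * coefficients L :=
    coefficients_eq_transpose_mul fun X => rfl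
  have h1 : slotCoefficients (tensorApply (Function.update (fun _ => 1) i U) Ψ)
      (tensorApply (Function.update (fun _ => 1) i V) χ) i M = coefficients L' * Vᵀ := by
    refine coefficients_eq_mul_transpose fun X => ?_
    change amplitude _ _ (Function.update M i X) =
      amplitude Ψ χ (Function.update M i (Uᴴ * (X * V)))
    rw [amplitude_tensorApply]
    congr 1
    funext l
    rcases eq_or_ne l i with rfl | hl
    · simp
    · simp [hl]
  rw [h1, h2]
  rfl

/-- Unitaries at position `i` multiply the coefficient matrix on either side and preserve its
Hilbert-Schmidt norm, on which alone the conditional moment depends. -/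
theorem overlapMoment_tensorApply_update (m : ℕ) {D d : Fin n → ℕ} (i : Fin n)
    {U : Matrix (Fin (D i)) (Fin (D i)) ℂ} (hU : Uᴴ * U = 1)
    {V : Matrix (Fin (d i)) (Fin (d i)) ℂ} (hV : Vᴴ * V = 1) (Ψ : Ket D) (χ : Ket d) :
    overlapMoment m (tensorApply (Function.update (fun _ => 1) i U) Ψ)
      (tensorApply (Function.update (fun _ => 1) i V) χ) = overlapMoment m Ψ χ := by
  unfold overlapMoment
  refine lintegral_eq_of_lmarginal_eq {i} (measurable_enorm_amplitude_pow m _ _)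
    (measurable_enorm_amplitude_pow m Ψ χ) ?_
  rw [lmarginal_singleton, lmarginal_singleton]
  funext G
  rw [lmarginal_enorm_amplitude_pow, lmarginal_enorm_amplitude_pow,
    slotCoefficients_tensorApply_update, frobeniusSq_mul_transpose hV, frobeniusSq_transpose_mul]
  rwa [Matrix.conjTranspose_conjTranspose]

theorem tensorApply_piecewise_insert {d : Fin n → ℕ}
    (U : (l : Fin n) → Matrix (Fin (d l)) (Fin (d l)) ℂ) {i : Fin n} {S : Finset (Fin n)}
    (hi : i ∉ S) (ψ : Ket d) :
    tensorApply ((insert i S).piecewise U fun _ => 1) ψ =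
      tensorApply (Function.update (fun _ => 1) i (U i))
        (tensorApply (S.piecewise U fun _ => 1) ψ) := by
  rw [tensorApply_tensorApply]
  congr 1
  funext l
  rcases eq_or_ne l i with rfl | hl
  · simp [hi]
  · simp [hl, Finset.piecewise]

theorem overlapMoment_tensorApply (m : ℕ) {D d : Fin n → ℕ}
    {U : (l : Fin n) → Matrix (Fin (D l)) (Fin (D l)) ℂ} (hU : ∀ l, (U l)ᴴ * U l = 1)
    {V : (l : Fin n) → Matrix (Fin (d l)) (Fin (d l)) ℂ} (hV : ∀ l, (V l)ᴴ * V l = 1)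
    (Ψ : Ket D) (χ : Ket d) :
    overlapMoment m (tensorApply U Ψ) (tensorApply V χ) = overlapMoment m Ψ χ := by
  have key : ∀ S : Finset (Fin n), overlapMoment m (tensorApply (S.piecewise U fun _ => 1) Ψ)
      (tensorApply (S.piecewise V fun _ => 1) χ) = overlapMoment m Ψ χ := by
    intro S
    induction S using Finset.induction_on with
    | empty => rw [Finset.piecewise_empty, Finset.piecewise_empty, tensorApply_one, tensorApply_one]
    | insert i S hi ih =>
      rw [tensorApply_piecewise_insert U hi, tensorApply_piecewise_insert V hi,
        overlapMoment_tensorApply_update m i (hU i) (hV i), ih]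
  simpa using key Finset.univ

end

/-! ### Finiteness and upper bound of the moments; the resulting monotones. -/

noncomputable section

open MeasureTheory ProbabilityTheory ENNReal

variable {n : ℕ}

theorem lintegral_enorm_prod_pow (m : ℕ) (u a : Fin n → ℕ) :
    ∫⁻ G, ‖∏ l, G l (u l, a l)‖ₑ ^ (2 * m) ∂(Measure.pi fun _ : Fin n => gaussianArray) =
      gaussianArray.moment m ^ n := by
  have hind := iIndepFun_pi (μ := fun _ : Fin n => gaussianArray)
    (X := fun l g => ‖g (u l, a l)‖ₑ ^ (2 * m)) (fun l => Measurable.aemeasurable (by fun_prop))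
  have h := lintegral_prod_eq_prod_lintegral_of_indepFun Finset.univ _ hind (fun l => by fun_prop)
  have h1 (l : Fin n) : ∫⁻ G : Fin n → ℕ × ℕ → ℂ, ‖G l (u l, a l)‖ₑ ^ (2 * m)
      ∂(Measure.pi fun _ : Fin n => gaussianArray) = gaussianArray.moment m := by
    have e1 : ∫⁻ G : Fin n → ℕ × ℕ → ℂ, ‖G l (u l, a l)‖ₑ ^ (2 * m)
        ∂(Measure.pi fun _ : Fin n => gaussianArray) =
        ∫⁻ g, ‖g (u l, a l)‖ₑ ^ (2 * m) ∂gaussianArray :=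
      (measurePreserving_eval (fun _ : Fin n => gaussianArray) l).lintegral_comp
        (f := fun g => ‖g (u l, a l)‖ₑ ^ (2 * m)) (by fun_prop)
    have e2 : gaussianArray.map (fun g => g (u l, a l)) = stdGaussian ℂ :=
      Measure.infinitePi_map_eval (fun _ => stdGaussian ℂ) _
    rw [e1, gaussianArray.moment, ← e2, lintegral_map (by fun_prop) (by fun_prop)]
  simp_rw [h1] at h
  simp only [Finset.prod_const, Finset.card_univ, Fintype.card_fin] at h
  rw [← h]
  refine lintegral_congr fun G => ?_
  rw [Finset.prod_pow, enorm_eq_nnnorm, nnnorm_prod, ENNReal.ofNNReal_finsetProd]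
  rfl

theorem overlapMoment_ne_top (m : ℕ) {D d : Fin n → ℕ} (Ψ : Ket D) (χ : Ket d) :
    overlapMoment m Ψ χ ≠ ∞ := by
  rcases Nat.eq_zero_or_pos m with rfl | hm
  · simp [overlapMoment]
  have hp : ((2 * m : ℕ) : ℝ≥0∞) ≠ 0 := by simpa using hm.ne'
  have hp' := ENNReal.natCast_ne_top (2 * m)
  have key : MemLp (fun G => amplitude Ψ χ (truncate D d G)) ((2 * m : ℕ) : ℝ≥0∞)
      (Measure.pi fun _ : Fin n => gaussianArray) := by
    have h1 : (fun G => amplitude Ψ χ (truncate D d G)) = fun G : Fin n → ℕ × ℕ → ℂ =>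
        ∑ j, ∑ k, star (Ψ j) * ((∏ l, G l (j l, k l)) * χ k) := by
      funext G
      rw [amplitude_apply, inner_ket]
      simp only [tensorApply_apply, Finset.mul_sum, truncate, Matrix.of_apply]
    rw [h1]
    refine memLp_finsetSum _ fun j _ => memLp_finsetSum _ fun k _ => ?_
    refine MemLp.const_mul (MemLp.mul_const ?_ _) _
    refine ⟨Measurable.aestronglyMeasurable (by fun_prop), ?_⟩
    rw [eLpNorm_lt_top_iff_lintegral_rpow_enorm_lt_top hp hp']
    simp only [ENNReal.toReal_natCast, ENNReal.rpow_natCast]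
    rw [lintegral_enorm_prod_pow m (fun l => (j l : ℕ)) (fun l => (k l : ℕ))]
    exact ENNReal.pow_lt_top (gaussianArray.moment_ne_top m).lt_top
  have h2 := lintegral_rpow_enorm_lt_top_of_eLpNorm_lt_top hp hp' key.2
  simp only [ENNReal.toReal_natCast, ENNReal.rpow_natCast] at h2
  exact h2.ne

theorem overlapMoment_smul (m : ℕ) {D d : Fin n → ℕ} (Ψ : Ket D) {c : ℂ} (hc : ‖c‖ = 1)
    (χ : Ket d) : overlapMoment m Ψ (c • χ) = overlapMoment m Ψ χ := by
  have hc' : ‖c‖ₑ = 1 := by rw [← ofReal_norm, hc, ENNReal.ofReal_one]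
  simp [overlapMoment, amplitude_smul_right, enorm_mul, hc']

/-- The vector `1` of the tensor product of `n` copies of `ℂ`. -/
def unitKet (n : ℕ) : Ket (fun _ : Fin n => 1) := WithLp.toLp 2 fun _ => 1

/-- Measuring one party in its basis and discarding it reduces its dimension to `1` and does not
decrease the moment on average. Once every party is measured, only a phase times `unitKet n`
remains. -/
theorem overlapMoment_le_unitKet (m : ℕ) {D : Fin n → ℕ} (Ψ : Ket D) (S : Finset (Fin n)) :
    ∀ (d : Fin n → ℕ) (χ : Ket d), IsState χ → (∀ l ∉ S, d l = 1) →
      overlapMoment m Ψ χ ≤ overlapMoment m Ψ (unitKet n) := by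
  induction S using Finset.induction_on with
  | empty =>
    intro d χ hχ hd
    obtain rfl : d = fun _ => 1 := funext fun l => hd l (by simp)
    have h : χ = χ (fun _ => 0) • unitKet n := by
      ext j
      rw [Subsingleton.elim j fun _ => 0]
      simp [unitKet]
    have hu : ‖unitKet n‖ = 1 := by
      simp [unitKet, EuclideanSpace.norm_eq]
    have hc : ‖χ (fun _ => 0)‖ = 1 := by
      have h1 : ‖χ‖ = 1 := hχ
      rwa [h, norm_smul, hu, mul_one] at h1
    rw [h, overlapMoment_smul m Ψ hc]
  | insert i S hi ih =>
    intro d χ hχ hd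
    obtain ⟨d', hd'i, hd'⟩ : ∃ d' : Fin n → ℕ, d' i = 1 ∧ ∀ l, l ≠ i → d' l = d l :=
      ⟨Function.update d i 1, by simp, fun l hl => by simp [hl]⟩
    -- The rows `⟨k|` of the basis measurement, as maps to a one-dimensional space.
    let A : Fin (d i) → Matrix (Fin (d' i)) (Fin (d i)) ℂ :=
      fun k => Matrix.of fun _ b => if b = k then 1 else 0
    have hA : ∑ k, (A k)ᴴ * A k = 1 := by
      ext b c
      simp [Matrix.sum_apply, Matrix.mul_apply, A, hd'i, Matrix.one_apply, eq_comm]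
    refine (overlapMoment_le_sum m hd' A hA Ψ hχ).trans ?_
    have hp : ∑ k, ‖(applyAt i (A k) χ : Ket d')‖ ^ 2 = 1 := by
      rw [sum_norm_sq_applyAt hd' A hA, show ‖χ‖ = 1 from hχ, one_pow]
    calc _ ≤ ∑ k, ENNReal.ofReal (‖(applyAt i (A k) χ : Ket d')‖ ^ 2) *
          overlapMoment m Ψ (unitKet n) := by
          refine Finset.sum_le_sum fun k _ => ?_
          rcases eq_or_ne (applyAt i (A k) χ : Ket d') 0 with h0 | h0
          · simp [h0]
          · refine mul_le_mul_right (ih d' _ (isState_normalized h0) fun l hl => ?_) _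
            rcases eq_or_ne l i with rfl | hli
            · exact hd'i
            · rw [hd' l hli, hd l (by simp [hl, hli])]
      _ = overlapMoment m Ψ (unitKet n) := by
          rw [← Finset.sum_mul, ← ENNReal.ofReal_sum_of_nonneg fun _ _ => by positivity, hp]
          simp

theorem isProductKet_smul [NeZero n] {d : Fin n → ℕ} {ψ : Ket d} (h : IsProductKet ψ) (c : ℂ) :
    IsProductKet (c • ψ) := by
  obtain ⟨v, hv⟩ := h
  refine ⟨Function.update v 0 (c • v 0), fun j => ?_⟩
  rw [PiLp.smul_apply, hv, smul_eq_mul, ← Finset.mul_prod_erase _ _ (Finset.mem_univ 0),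
    ← Finset.mul_prod_erase _ _ (Finset.mem_univ 0), ← mul_assoc]
  rw [Function.update_self, Pi.smul_apply, smul_eq_mul]
  congr 1
  exact Finset.prod_congr rfl fun l hl => by rw [Function.update_of_ne (Finset.ne_of_mem_erase hl)]

theorem isProductKet_tensorApply {d d' : Fin n → ℕ} {ψ : Ket d} (h : IsProductKet ψ)
    (A : (l : Fin n) → Matrix (Fin (d' l)) (Fin (d l)) ℂ) : IsProductKet (tensorApply A ψ) := by
  obtain ⟨v, hv⟩ := h
  refine ⟨fun l => A l *ᵥ v l, fun j => ?_⟩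
  simp only [tensorApply_apply, hv, Matrix.mulVec, dotProduct, ← Finset.prod_mul_distrib,
    Fintype.prod_sum]

open Classical in
/-- The entanglement monotone built from the Gaussian average of the overlap with `Ψ`. -/
def overlapMonotone (m : ℕ) {D : Fin n → ℕ} (Ψ : Ket D) (d : Fin n → ℕ) (χ : Ket d) : ℝ :=
  if IsProductKet χ then 0
  else 1 + (overlapMoment m Ψ (unitKet n)).toReal - (overlapMoment m Ψ χ).toReal

theorem one_le_overlapMonotone (m : ℕ) {D d : Fin n → ℕ} (Ψ : Ket D) {χ : Ket d} (hχ : IsState χ)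
    (h : ¬ IsProductKet χ) : 1 ≤ overlapMonotone m Ψ d χ := by
  rw [overlapMonotone, if_neg h]
  have := ENNReal.toReal_mono (overlapMoment_ne_top m Ψ _)
    (overlapMoment_le_unitKet m Ψ Finset.univ d χ hχ (by simp))
  linarith

theorem overlapMonotone_le (m : ℕ) {D d : Fin n → ℕ} (Ψ : Ket D) {χ : Ket d} (hχ : IsState χ) :
    overlapMonotone m Ψ d χ ≤
      1 + (overlapMoment m Ψ (unitKet n)).toReal - (overlapMoment m Ψ χ).toReal := by
  have := ENNReal.toReal_mono (overlapMoment_ne_top m Ψ _)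
    (overlapMoment_le_unitKet m Ψ Finset.univ d χ hχ (by simp))
  unfold overlapMonotone
  split_ifs <;> linarith

/-- Product states only yield product outcomes, so the reset to `0` is consistent. For other states
the reset can only lower the outcome values, because the formula is everywhere at least `1`. -/
theorem isEntanglementMonotone_overlapMonotone [NeZero n] (m : ℕ) {D : Fin n → ℕ} (Ψ : Ket D) :
    IsEntanglementMonotone (fun d => overlapMonotone m Ψ d) where
  nonneg d χ hχ := by
    by_cases h : IsProductKet χ
    · simp [overlapMonotone, h]
    · exact zero_le_one.trans (one_le_overlapMonotone m Ψ hχ h)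
  product d χ _ h := by simp [overlapMonotone, h]
  monotone d d' i hd r A hA χ hχ := by
    by_cases h : IsProductKet χ
    · have h' (k : Fin r) : IsProductKet (normalized (applyAt i (A k) χ : Ket d')) :=
        isProductKet_smul (isProductKet_tensorApply h _) _
      simp [overlapMonotone, h, h']
    · have hp : ∑ k, ‖(applyAt i (A k) χ : Ket d')‖ ^ 2 = 1 := by
        rw [sum_norm_sq_applyAt hd A hA, show ‖χ‖ = 1 from hχ, one_pow]
      have hK := ENNReal.toReal_mono (ENNReal.sum_ne_top.2 fun k _ =>
        ENNReal.mul_ne_top ENNReal.ofReal_ne_top (overlapMoment_ne_top m Ψ _))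
        (overlapMoment_le_sum m hd A hA Ψ hχ)
      rw [ENNReal.toReal_sum fun k _ =>
        ENNReal.mul_ne_top ENNReal.ofReal_ne_top (overlapMoment_ne_top m Ψ _)] at hK
      simp_rw [ENNReal.toReal_mul, ENNReal.toReal_ofReal (sq_nonneg ‖_‖)] at hK
      rw [overlapMonotone, if_neg h]
      calc _ ≤ ∑ k, ‖(applyAt i (A k) χ : Ket d')‖ ^ 2 *
            (1 + (overlapMoment m Ψ (unitKet n)).toReal -
              (overlapMoment m Ψ (normalized (applyAt i (A k) χ : Ket d'))).toReal) := by
            refine Finset.sum_le_sum fun k _ => ?_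
            rcases eq_or_ne (applyAt i (A k) χ : Ket d') 0 with h0 | h0
            -- An outcome of probability zero normalizes to the vector `0`, which is not a state;
            -- its weight removes it.
            · simp [h0]
            · gcongr
              exact overlapMonotone_le m Ψ (isState_normalized h0)
        _ ≤ _ := by
            simp_rw [mul_sub, Finset.sum_sub_distrib]
            rw [← Finset.sum_mul, hp]
            linarith

/-! ### Monotones are constant on local unitary orbits. -/

section LocalUnitary

theorem norm_tensorApply {d : Fin n → ℕ} {U : (l : Fin n) → Matrix (Fin (d l)) (Fin (d l)) ℂ}
    (hU : ∀ l, (U l)ᴴ * U l = 1) (ψ : Ket d) : ‖tensorApply U ψ‖ = ‖ψ‖ := by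
  have h : inner ℂ (tensorApply U ψ) (tensorApply U ψ) = inner ℂ ψ ψ := by
    rw [inner_tensorApply_left, tensorApply_tensorApply, funext hU]
    exact congrArg _ (tensorApply_one ψ)
  rw [@norm_eq_sqrt_re_inner ℂ, @norm_eq_sqrt_re_inner ℂ, h]

theorem applyAt_self {d : Fin n → ℕ} (i : Fin n) (U : Matrix (Fin (d i)) (Fin (d i)) ℂ)
    (ψ : Ket d) :
    (applyAt i U ψ : Ket d) = tensorApply (Function.update (fun _ => 1) i U) ψ := by
  simp only [applyAt, idMatrix_self]

theorem IsEntanglementMonotone.apply_update_le {E : (d : Fin n → ℕ) → Ket d → ℝ}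
    (hE : IsEntanglementMonotone E) {d : Fin n → ℕ} (i : Fin n)
    {U : Matrix (Fin (d i)) (Fin (d i)) ℂ} (hU : Uᴴ * U = 1) {ψ : Ket d} (hψ : IsState ψ) :
    E d (tensorApply (Function.update (fun _ => 1) i U) ψ) ≤ E d ψ := by
  have h := hE.monotone d d i (fun _ _ => rfl) 1 (fun _ => U) (by simpa using hU) ψ hψ
  have h1 : ‖tensorApply (Function.update (fun _ => 1) i U) ψ‖ = 1 := by
    rw [norm_tensorApply, show ‖ψ‖ = 1 from hψ]
    intro l
    rcases eq_or_ne l i with rfl | hl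
    · simpa using hU
    · simp [hl]
  simpa [applyAt_self, h1, normalized_of_isState h1] using h

theorem IsEntanglementMonotone.apply_tensorApply_le {E : (d : Fin n → ℕ) → Ket d → ℝ}
    (hE : IsEntanglementMonotone E) {d : Fin n → ℕ}
    {U : (l : Fin n) → Matrix (Fin (d l)) (Fin (d l)) ℂ} (hU : ∀ l, (U l)ᴴ * U l = 1)
    {ψ : Ket d} (hψ : IsState ψ) : E d (tensorApply U ψ) ≤ E d ψ := by
  have key : ∀ S : Finset (Fin n), E d (tensorApply (S.piecewise U fun _ => 1) ψ) ≤ E d ψ := by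
    intro S
    induction S using Finset.induction_on with
    | empty => rw [Finset.piecewise_empty, tensorApply_one]
    | insert i S hi ih =>
      rw [tensorApply_piecewise_insert U hi]
      refine (hE.apply_update_le i (hU i) ?_).trans ih
      rw [IsState, norm_tensorApply, show ‖ψ‖ = 1 from hψ]
      intro l
      by_cases hl : l ∈ S <;> simp [hl, hU]
  simpa using key Finset.univ

theorem LocalUnitaryEquivalent.symm {d : Fin n → ℕ} {ψ φ : Ket d}
    (h : LocalUnitaryEquivalent ψ φ) : LocalUnitaryEquivalent φ ψ := by
  obtain ⟨U, hU, rfl⟩ := h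
  refine ⟨fun l => (U l)ᴴ, fun l => Unitary.star_mem (hU l), ?_⟩
  rw [tensorApply_tensorApply]
  have h (l : Fin n) : (U l)ᴴ * U l = 1 := (Unitary.mem_iff.1 (hU l)).1
  simp_rw [h, tensorApply_one]

theorem IsEntanglementMonotone.eq_of_localUnitaryEquivalent {E : (d : Fin n → ℕ) → Ket d → ℝ}
    (hE : IsEntanglementMonotone E) {d : Fin n → ℕ} {ψ φ : Ket d} (hψ : IsState ψ)
    (hφ : IsState φ) (h : LocalUnitaryEquivalent ψ φ) : E d ψ = E d φ := by
  apply le_antisymm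
  · obtain ⟨U, hU, rfl⟩ := h.symm
    exact hE.apply_tensorApply_le (fun l => (Unitary.mem_iff.1 (hU l)).1) hφ
  · obtain ⟨U, hU, rfl⟩ := h
    exact hE.apply_tensorApply_le (fun l => (Unitary.mem_iff.1 (hU l)).1) hψ

end LocalUnitary

end

/-! ### Unitary extension, polar decomposition and equivalence of product states. -/

noncomputable section

theorem inner_toEuclideanLin {ι κ : Type*} [Fintype ι] [DecidableEq ι] [Fintype κ] [DecidableEq κ]
    (C : Matrix ι κ ℂ) (x y : EuclideanSpace ℂ κ) :
    inner ℂ (Matrix.toEuclideanLin C x) (Matrix.toEuclideanLin C y) =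
      inner ℂ x (Matrix.toEuclideanLin (Cᴴ * C) y) := by
  rw [← LinearMap.adjoint_inner_right, ← Matrix.toEuclideanLin_conjTranspose_eq_adjoint]
  congr 1
  simp [Matrix.toLpLin_apply, Matrix.mulVec_mulVec]

/-- Equal Gram matrices make `A x ↦ B x` a well-defined isometry on the range of `A`; in finite
dimension it extends to a unitary. -/
theorem exists_unitary_mul_eq {ι κ : Type*} [Fintype ι] [DecidableEq ι] [Fintype κ] [DecidableEq κ]
    (A B : Matrix ι κ ℂ) (h : Aᴴ * A = Bᴴ * B) : ∃ U ∈ Matrix.unitaryGroup ι ℂ, U * A = B := by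
  let f := Matrix.toEuclideanLin A
  let g := Matrix.toEuclideanLin B
  have hnorm : ∀ x, ‖f x‖ = ‖g x‖ := by
    intro x
    rw [@norm_eq_sqrt_re_inner ℂ, @norm_eq_sqrt_re_inner ℂ, inner_toEuclideanLin,
      inner_toEuclideanLin, h]
  obtain ⟨s, hs⟩ := f.rangeRestrict.exists_rightInverse_of_surjective f.range_rangeRestrict
  have hs' (y : LinearMap.range f) : f (s y) = y := congrArg Subtype.val (LinearMap.congr_fun hs y)
  let L : LinearMap.range f →ₗᵢ[ℂ] EuclideanSpace ℂ ι :=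
    ⟨g ∘ₗ s, fun y => by rw [LinearMap.comp_apply, ← hnorm, hs']; rfl⟩
  have hL (x : EuclideanSpace ℂ κ) : L.extend (f x) = g x := by
    have h1 : L.extend (f x) = g (s (f.rangeRestrict x)) :=
      L.extend_apply (f.rangeRestrict x)
    -- The chosen preimage of `f x` differs from `x` by a vector in the kernel of `f`, which `g`
    -- also kills since `‖f x‖ = ‖g x‖`.
    rw [h1, ← sub_eq_zero, ← map_sub, ← norm_eq_zero, ← hnorm, norm_eq_zero, map_sub, hs',
      sub_eq_zero]
    rfl
  let U := Matrix.toEuclideanLin.symm L.extend.toLinearMap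
  have hU : Matrix.toEuclideanLin U = L.extend.toLinearMap := LinearEquiv.apply_symm_apply _ _
  refine ⟨U, ?_, ?_⟩
  · rw [Matrix.mem_unitaryGroup_iff', Matrix.star_eq_conjTranspose]
    apply Matrix.toEuclideanLin.injective
    refine LinearMap.ext fun y => ext_inner_left ℂ fun x => ?_
    rw [← inner_toEuclideanLin, hU]
    simp
  · apply Matrix.toEuclideanLin.injective
    refine LinearMap.ext fun x => ?_
    have h1 : Matrix.toEuclideanLin (U * A) x = Matrix.toEuclideanLin U (f x) := by
      simp [f, Matrix.toLpLin_apply, Matrix.mulVec_mulVec]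
    rw [h1, hU]
    exact hL x

open scoped ComplexOrder MatrixOrder Matrix.Norms.L2Operator in
theorem exists_polar {ι : Type*} [Fintype ι] [DecidableEq ι] (M : Matrix ι ι ℂ) :
    ∃ U ∈ Matrix.unitaryGroup ι ℂ, ∃ B : Matrix ι ι ℂ, M = U * (Bᴴ * B) := by
  have h0 : (0 : Matrix ι ι ℂ) ≤ Mᴴ * M :=
    Matrix.nonneg_iff_posSemidef.2 (Matrix.posSemidef_conjTranspose_mul_self M)
  have h1 : (CFC.sqrt (Mᴴ * M)).PosSemidef :=
    Matrix.nonneg_iff_posSemidef.1 (CFC.sqrt_nonneg _)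
  have h2 : (CFC.sqrt (Mᴴ * M))ᴴ * CFC.sqrt (Mᴴ * M) = Mᴴ * M := by
    rw [h1.isHermitian.eq]
    exact CFC.sqrt_mul_sqrt_self _ h0
  obtain ⟨U, hU, hUM⟩ := exists_unitary_mul_eq _ _ h2
  obtain ⟨B, hB⟩ := CStarAlgebra.nonneg_iff_eq_star_mul_self.1 (CFC.sqrt_nonneg (Mᴴ * M))
  exact ⟨U, hU, B, by rw [← hUM, hB]; rfl⟩

theorem exists_unitary_mulVec_eq {ι : Type*} [Fintype ι] [DecidableEq ι] {v w : ι → ℂ}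
    (hv : ∑ a, ‖v a‖ ^ 2 = 1) (hw : ∑ a, ‖w a‖ ^ 2 = 1) :
    ∃ U ∈ Matrix.unitaryGroup ι ℂ, U *ᵥ v = w := by
  have h (u : ι → ℂ) (hu : ∑ a, ‖u a‖ ^ 2 = 1) :
      (Matrix.replicateCol Unit u)ᴴ * Matrix.replicateCol Unit u = 1 := by
    ext x y
    rw [Matrix.mul_apply]
    simp only [Matrix.conjTranspose_apply, Matrix.replicateCol_apply]
    have : ∀ a, star (u a) * u a = ((‖u a‖ ^ 2 : ℝ) : ℂ) := fun a => by
      simpa using Complex.conj_mul' (u a)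
    simp_rw [this]
    rw [← Complex.ofReal_sum, hu]
    simp
  obtain ⟨U, hU, hUv⟩ := exists_unitary_mul_eq _ _ ((h v hv).trans (h w hw).symm)
  refine ⟨U, hU, ?_⟩
  rw [← Matrix.replicateCol_mulVec] at hUv
  exact Matrix.replicateCol_injective hUv

theorem IsProductKet.exists_unit_factors {n : ℕ} {d : Fin n → ℕ} {ψ : Ket d} (h : IsProductKet ψ)
    (hψ : IsState ψ) : ∃ v : (l : Fin n) → Fin (d l) → ℂ,
      (∀ l, ∑ a, ‖v l a‖ ^ 2 = 1) ∧ ∀ j, ψ j = ∏ l, v l (j l) := by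
  obtain ⟨v, hv⟩ := h
  let s : Fin n → ℝ := fun l => ∑ a, ‖v l a‖ ^ 2
  have hs0 (l : Fin n) : 0 ≤ s l := by positivity
  have hs : ∏ l, s l = 1 := by
    have h1 : ‖ψ‖ ^ 2 = 1 := by rw [show ‖ψ‖ = 1 from hψ, one_pow]
    rw [EuclideanSpace.norm_sq_eq] at h1
    simp_rw [hv, norm_prod, ← Finset.prod_pow] at h1
    rw [← h1, Fintype.prod_sum]
  have hspos (l : Fin n) : 0 < s l := by
    refine (hs0 l).lt_of_ne' fun h0 => ?_
    rw [Finset.prod_eq_zero (Finset.mem_univ l) h0] at hs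
    exact zero_ne_one hs
  -- The squared norms `s l` multiply to `1`, so normalizing every factor leaves the product
  -- unchanged.
  refine ⟨fun l a => ((√(s l))⁻¹ : ℝ) * v l a, fun l => ?_, fun j => ?_⟩
  · simp only [norm_mul, Complex.norm_real, mul_pow, Real.norm_eq_abs, sq_abs, inv_pow,
      Real.sq_sqrt (hs0 l), ← Finset.mul_sum]
    exact inv_mul_cancel₀ (hspos l).ne'
  · rw [Finset.prod_mul_distrib, ← Complex.ofReal_prod, Finset.prod_inv_distrib,
      ← Real.sqrt_prod _ fun l _ => hs0 l, hs, hv]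
    simp

theorem IsProductKet.localUnitaryEquivalent {n : ℕ} {d : Fin n → ℕ} {ψ φ : Ket d}
    (hψp : IsProductKet ψ) (hφp : IsProductKet φ) (hψ : IsState ψ) (hφ : IsState φ) :
    LocalUnitaryEquivalent ψ φ := by
  obtain ⟨v, hv, hψv⟩ := hψp.exists_unit_factors hψ
  obtain ⟨w, hw, hφw⟩ := hφp.exists_unit_factors hφ
  choose U hU hUv using fun l => exists_unitary_mulVec_eq (hv l) (hw l)
  refine ⟨U, hU, ?_⟩
  ext j
  rw [tensorApply_apply, hφw, ← funext hUv]
  simp only [hψv, Matrix.mulVec, dotProduct, ← Finset.prod_mul_distrib, Fintype.prod_sum]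

end

/-! ### The compact group of local unitaries, tensor power features and density. -/

noncomputable section

open MeasureTheory

instance {a b : ℕ} : SecondCountableTopology (Matrix (Fin a) (Fin b) ℂ) :=
  inferInstanceAs (SecondCountableTopology (Fin a → Fin b → ℂ))

instance {a b : ℕ} : LocallyCompactSpace (Matrix (Fin a) (Fin b) ℂ) :=
  inferInstanceAs (LocallyCompactSpace (Fin a → Fin b → ℂ))

instance {a : ℕ} : SecondCountableTopology (Matrix.unitaryGroup (Fin a) ℂ) :=
  TopologicalSpace.Subtype.secondCountableTopology _

instance {a : ℕ} : CompactSpace (Matrix.unitaryGroup (Fin a) ℂ) := by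
  refine isCompact_iff_compactSpace.1 ?_
  have h : IsCompact (Set.pi Set.univ fun _ : Fin a => Set.pi Set.univ fun _ : Fin a =>
      Metric.closedBall (0 : ℂ) 1) :=
    isCompact_univ_pi fun _ => isCompact_univ_pi fun _ => isCompact_closedBall _ _
  have h' : IsClosed (unitary (Matrix (Fin a) (Fin a) ℂ) : Set (Matrix (Fin a) (Fin a) ℂ)) :=
    isClosed_unitary
  refine IsCompact.of_isClosed_subset (X := Matrix (Fin a) (Fin a) ℂ) h h' ?_
  intro U hU i _ j _
  simpa using entry_norm_bound_of_unitary hU i j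

variable {n : ℕ} {d : Fin n → ℕ}

/-- The group of local unitaries. -/
abbrev LocalUnitaries (d : Fin n → ℕ) : Type :=
  (l : Fin n) → Matrix.unitaryGroup (Fin (d l)) ℂ

/-- The action of a local unitary on a vector. -/
def LocalUnitaries.act (U : LocalUnitaries d) (ψ : Ket d) : Ket d :=
  tensorApply (fun l => (U l : Matrix (Fin (d l)) (Fin (d l)) ℂ)) ψ

namespace LocalUnitaries

theorem conjTranspose_mul_self (U : LocalUnitaries d) (l : Fin n) :
    (U l : Matrix (Fin (d l)) (Fin (d l)) ℂ)ᴴ * U l = 1 :=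
  (Unitary.mem_iff.1 (U l).2).1

theorem norm_act (U : LocalUnitaries d) (ψ : Ket d) : ‖U.act ψ‖ = ‖ψ‖ :=
  norm_tensorApply U.conjTranspose_mul_self ψ

theorem mul_act (U V : LocalUnitaries d) (ψ : Ket d) : (U * V).act ψ = U.act (V.act ψ) := by
  rw [act, act, act, tensorApply_tensorApply]
  rfl

theorem one_act (ψ : Ket d) : (1 : LocalUnitaries d).act ψ = ψ := tensorApply_one ψ

theorem localUnitaryEquivalent_act (U : LocalUnitaries d) (ψ : Ket d) :
    LocalUnitaryEquivalent ψ (U.act ψ) := ⟨fun l => U l, fun l => (U l).2, rfl⟩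

end LocalUnitaries

theorem LocalUnitaryEquivalent.trans {ψ φ χ : Ket d} (h : LocalUnitaryEquivalent ψ φ)
    (h' : LocalUnitaryEquivalent φ χ) : LocalUnitaryEquivalent ψ χ := by
  obtain ⟨U, hU, rfl⟩ := h
  obtain ⟨V, hV, rfl⟩ := h'
  exact ⟨fun l => V l * U l, fun l => mul_mem (hV l) (hU l), tensorApply_tensorApply _ _ _⟩

/-- The phase is absorbed by the unitary of party `0`; this needs at least one party. -/
theorem localUnitaryEquivalent_smul [NeZero n] {c : ℂ} (hc : ‖c‖ = 1) (ψ : Ket d) :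
    LocalUnitaryEquivalent ψ (c • ψ) := by
  refine ⟨Function.update (fun _ => 1) 0 (c • 1), fun l => ?_, ?_⟩
  · rcases eq_or_ne l 0 with rfl | hl
    · rw [Function.update_self, Matrix.mem_unitaryGroup_iff']
      have : star c * c = 1 := by simpa [hc] using Complex.conj_mul' c
      simp only [star_smul, star_one, Algebra.mul_smul_comm, mul_one, smul_smul]
      rw [mul_comm, this, one_smul]
    · rw [Function.update_of_ne hl]
      exact one_mem _
  · ext j
    have h := congrArg (· j) (tensorApply_one (c • ψ))
    dsimp only at h
    rw [← h, tensorApply_smul, PiLp.smul_apply, tensorApply_apply, tensorApply_apply,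
      smul_eq_mul, Finset.mul_sum]
    refine Finset.sum_congr rfl fun k _ => ?_
    rw [← mul_assoc, ← Finset.mul_prod_erase _ _ (Finset.mem_univ 0),
      ← Finset.mul_prod_erase _ _ (Finset.mem_univ 0), ← mul_assoc, Function.update_self,
      Matrix.smul_apply, smul_eq_mul]
    congr 2
    exact Finset.prod_congr rfl fun l hl => by rw [Function.update_of_ne (Finset.ne_of_mem_erase hl)]

theorem Continuous.tensorApply {X : Type*} [TopologicalSpace X] {d' : Fin n → ℕ}
    {M : X → (l : Fin n) → Matrix (Fin (d' l)) (Fin (d l)) ℂ} (hM : Continuous M)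
    {ψ : X → Ket d} (hψ : Continuous ψ) : Continuous fun x => tensorApply (M x) (ψ x) := by
  unfold _root_.tensorApply
  fun_prop

theorem Continuous.act {X : Type*} [TopologicalSpace X] {U : X → LocalUnitaries d}
    (hU : Continuous U) {ψ : X → Ket d} (hψ : Continuous ψ) :
    Continuous fun x => (U x).act (ψ x) :=
  Continuous.tensorApply
    (continuous_pi fun l => continuous_subtype_val.comp ((continuous_apply l).comp hU)) hψ

theorem Continuous.norm_amplitude_act_pow {X : Type*} [TopologicalSpace X]
    {U V : X → LocalUnitaries d} (hU : Continuous U) (hV : Continuous V)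
    {M : X → (l : Fin n) → Matrix (Fin (d l)) (Fin (d l)) ℂ} (hM : Continuous M)
    (m : ℕ) (a b : Ket d) :
    Continuous fun x => ‖amplitude ((U x).act a) ((V x).act b) (M x)‖ ^ (2 * m) := by
  simp_rw [amplitude_apply]
  exact (((hU.act continuous_const).inner (hM.tensorApply (hV.act continuous_const))).norm).pow _

/-- The vector `a^(⊗m) ⊗ conj a^(⊗m)`. -/
def tensorPowerFeature (m : ℕ) (a : Ket d) :
    EuclideanSpace ℂ ((Fin m → (l : Fin n) → Fin (d l)) × (Fin m → (l : Fin n) → Fin (d l))) :=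
  WithLp.toLp 2 fun p => (∏ t, a (p.1 t)) * ∏ t, star (a (p.2 t))

/-- `|z|^(2m) = z^m * conj z^m`, and powers of an inner product are inner products of tensor powers.
This exhibits the kernel as positive semidefinite. -/
theorem inner_tensorPowerFeature (m : ℕ) (a b : Ket d) :
    inner ℂ (tensorPowerFeature m a) (tensorPowerFeature m b) =
      ((‖(inner ℂ a b : ℂ)‖ ^ (2 * m) : ℝ) : ℂ) := by
  have h : ((‖(inner ℂ a b : ℂ)‖ ^ (2 * m) : ℝ) : ℂ) = inner ℂ a b ^ m * star (inner ℂ a b) ^ m := by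
    rw [← mul_pow, pow_mul, Complex.ofReal_pow]
    congr 1
    simpa using (Complex.mul_conj' (inner ℂ a b : ℂ)).symm
  rw [h, inner_ket, star_sum, Fintype.sum_pow, Fintype.sum_pow, Finset.sum_mul_sum,
    ← Fintype.sum_prod_type', PiLp.inner_apply]
  refine Finset.sum_congr rfl fun p _ => ?_
  simp only [tensorPowerFeature, RCLike.inner_apply, map_mul, map_prod, star_mul',
    Finset.prod_mul_distrib, RCLike.star_def, RCLike.conj_conj]
  ring

theorem continuous_tensorPowerFeature (m : ℕ) :
    Continuous (tensorPowerFeature m : Ket d → _) := by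
  unfold tensorPowerFeature
  fun_prop

theorem Continuous.integrable_of_compactSpace {X E : Type*} [TopologicalSpace X] [CompactSpace X]
    [MeasurableSpace X] [OpensMeasurableSpace X] [NormedAddCommGroup E] [SecondCountableTopology E]
    {μ : Measure X} [IsFiniteMeasure μ] {f : X → E} (hf : Continuous f) : Integrable f μ :=
  hf.integrable_of_hasCompactSupport (HasCompactSupport.of_compactSpace f)

/-- Otherwise `D` would be nonzero on a whole box around `M`, which has positive Gaussian measure.
-/
theorem eq_zero_of_ae_truncate {D : ((l : Fin n) → Matrix (Fin (d l)) (Fin (d l)) ℂ) → ℝ}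
    (hD : Continuous D) (h : ∀ᵐ G ∂(Measure.pi fun _ : Fin n => gaussianArray),
      D (truncate d d G) = 0) (M : (l : Fin n) → Matrix (Fin (d l)) (Fin (d l)) ℂ) : D M = 0 := by
  by_contra hM
  let F : ((l : Fin n) → Fin (d l) → Fin (d l) → ℂ) → ℝ := fun N => D fun l => Matrix.of (N l)
  have hF : Continuous F := hD
  have hopen : IsOpen {N | F N ≠ 0} := isOpen_ne_fun hF continuous_const
  obtain ⟨ε, hε, hball⟩ := Metric.isOpen_iff.1 hopen (fun l u a => M l u a) hM
  have hpos : 0 < (Measure.pi fun _ : Fin n => gaussianArray) (Set.pi Set.univ fun l =>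
      {g | ∀ (u : Fin (d l)) (a : Fin (d l)), ‖g (u, a) - M l u a‖ < ε}) := by
    rw [Measure.pi_pi]
    exact pos_iff_ne_zero.2 <| Finset.prod_ne_zero_iff.2 fun l _ =>
      (gaussianArray.measure_setOf_norm_sub_lt_pos (M l) hε).ne'
  refine hpos.ne' (measure_mono_null (fun G hG => ?_) (ae_iff.1 h))
  refine hball (a := fun l u a => truncate d d G l u a) ?_
  rw [Metric.mem_ball, dist_pi_lt_iff hε]
  intro l
  rw [dist_pi_lt_iff hε]
  intro u
  rw [dist_pi_lt_iff hε]
  intro a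
  rw [dist_eq_norm]
  exact hG l (Set.mem_univ l) u a

end

/-! ### Averages over local unitaries as a positive semidefinite kernel. -/

noncomputable section

open MeasureTheory

variable {n : ℕ} {d : Fin n → ℕ} [MeasurableSpace (LocalUnitaries d)]
  (ν : Measure (LocalUnitaries d))

/-- The average over local unitaries `U`, `V` of `|⟨U a| M |V b⟩|^(2m)`. -/
def unitaryAverage (m : ℕ) (a b : Ket d) (M : (l : Fin n) → Matrix (Fin (d l)) (Fin (d l)) ℂ) : ℝ :=
  ∫ U, ∫ V, ‖amplitude (U.act a) (V.act b) M‖ ^ (2 * m) ∂ν ∂ν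

theorem unitaryAverage_nonneg (m : ℕ) (a b : Ket d)
    (M : (l : Fin n) → Matrix (Fin (d l)) (Fin (d l)) ℂ) : 0 ≤ unitaryAverage ν m a b M :=
  integral_nonneg fun _ => integral_nonneg fun _ => by positivity

variable [BorelSpace (LocalUnitaries d)] [IsProbabilityMeasure ν]

theorem continuous_integral_norm_amplitude_act_pow (m : ℕ) (a b : Ket d) :
    Continuous fun p : ((l : Fin n) → Matrix (Fin (d l)) (Fin (d l)) ℂ) × LocalUnitaries d =>
      ∫ V, ‖amplitude (p.2.act a) (V.act b) p.1‖ ^ (2 * m) ∂ν := by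
  have := continuous_parametric_integral_of_continuous (μ := ν)
    (f := fun (p : ((l : Fin n) → Matrix (Fin (d l)) (Fin (d l)) ℂ) × LocalUnitaries d) V =>
      ‖amplitude (p.2.act a) (V.act b) p.1‖ ^ (2 * m))
    (Continuous.norm_amplitude_act_pow (by fun_prop) (by fun_prop) (by fun_prop) m a b)
    isCompact_univ
  simpa only [Measure.restrict_univ] using this

theorem continuous_unitaryAverage (m : ℕ) (a b : Ket d) :
    Continuous (unitaryAverage ν m a b) := by
  have := continuous_parametric_integral_of_continuous (μ := ν)
    (f := fun (M : (l : Fin n) → Matrix (Fin (d l)) (Fin (d l)) ℂ) U =>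
      ∫ V, ‖amplitude (U.act a) (V.act b) M‖ ^ (2 * m) ∂ν)
    (continuous_integral_norm_amplitude_act_pow ν m a b) isCompact_univ
  simp only [Measure.restrict_univ] at this
  exact this

/-- The average over local unitaries `U` of the tensor power feature of `B U a`. -/
def averagedFeature (m : ℕ) (B : (l : Fin n) → Matrix (Fin (d l)) (Fin (d l)) ℂ) (a : Ket d) :
    EuclideanSpace ℂ ((Fin m → (l : Fin n) → Fin (d l)) × (Fin m → (l : Fin n) → Fin (d l))) :=
  ∫ U, tensorPowerFeature m (tensorApply B (LocalUnitaries.act U a)) ∂ν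

theorem integrable_tensorPowerFeature (m : ℕ)
    (B : (l : Fin n) → Matrix (Fin (d l)) (Fin (d l)) ℂ) (a : Ket d) :
    Integrable (fun U => tensorPowerFeature m (tensorApply B (LocalUnitaries.act U a))) ν :=
  Continuous.integrable_of_compactSpace <| (continuous_tensorPowerFeature m).comp
    (continuous_const.tensorApply (continuous_id.act continuous_const))

/-- For a fixed pair `U`, `V` the unitary part `W` of `M` spoils positivity. Moved to the left
argument it only translates `U`, which the invariant measure ignores; the positive part `Bᴴ * B`
splits evenly between both sides. -/
theorem unitaryAverage_eq_inner [ν.IsMulLeftInvariant] (m : ℕ)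
    {M W B : (l : Fin n) → Matrix (Fin (d l)) (Fin (d l)) ℂ}
    (hW : ∀ l, W l ∈ Matrix.unitaryGroup (Fin (d l)) ℂ) (hM : ∀ l, M l = W l * ((B l)ᴴ * B l))
    (a b : Ket d) :
    (unitaryAverage ν m a b M : ℂ) = inner ℂ (averagedFeature ν m B a) (averagedFeature ν m B b) := by
  let w : LocalUnitaries d := fun l => ⟨W l, hW l⟩
  have h1 (U V : LocalUnitaries d) : amplitude (U.act a) (V.act b) M =
      inner ℂ (tensorApply B ((w⁻¹ * U).act a)) (tensorApply B (V.act b)) := by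
    rw [amplitude_apply, inner_tensorApply_left, LocalUnitaries.mul_act, LocalUnitaries.act.eq_1 w⁻¹,
      inner_tensorApply_left, tensorApply_tensorApply, tensorApply_tensorApply]
    congr 2
    funext l
    rw [hM, show (w⁻¹) l = star (w l) from rfl, Unitary.coe_star, Matrix.star_eq_conjTranspose,
      Matrix.conjTranspose_conjTranspose, ← Matrix.mul_assoc]
  unfold unitaryAverage
  simp_rw [h1]
  rw [integral_mul_left_eq_self (μ := ν) (fun U : LocalUnitaries d =>
    ∫ V : LocalUnitaries d,
      ‖(inner ℂ (tensorApply B (U.act a)) (tensorApply B (V.act b)) : ℂ)‖ ^ (2 * m) ∂ν) w⁻¹]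
  rw [← integral_complex_ofReal]
  simp_rw [← integral_complex_ofReal, ← inner_tensorPowerFeature]
  simp_rw [integral_inner (integrable_tensorPowerFeature ν m B b)]
  change ∫ U, inner ℂ (tensorPowerFeature m (tensorApply B (LocalUnitaries.act U a)))
    (averagedFeature ν m B b) ∂ν = _
  rw [← inner_conj_symm (averagedFeature ν m B a), averagedFeature.eq_1 ν m B a,
    ← integral_inner (integrable_tensorPowerFeature ν m B a), ← integral_conj]
  simp_rw [inner_conj_symm]

/-- This is `‖f_a - f_b‖² ≥ 0` for the averaged features of `a` and `b`. -/
theorem unitaryAverage_add_le [ν.IsMulLeftInvariant] (m : ℕ) (a b : Ket d)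
    (M : (l : Fin n) → Matrix (Fin (d l)) (Fin (d l)) ℂ) :
    unitaryAverage ν m a b M + unitaryAverage ν m b a M ≤
      unitaryAverage ν m a a M + unitaryAverage ν m b b M := by
  choose W hW B hM using fun l => exists_polar (M l)
  have h (x y : Ket d) : unitaryAverage ν m x y M =
      RCLike.re (inner ℂ (averagedFeature ν m B x) (averagedFeature ν m B y)) := by
    rw [← unitaryAverage_eq_inner ν m hW hM]
    exact (Complex.ofReal_re _).symm
  have h2 := @norm_sub_sq ℂ _ _ _ _ (averagedFeature ν m B a) (averagedFeature ν m B b)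
  have h3 := sq_nonneg ‖averagedFeature ν m B a - averagedFeature ν m B b‖
  rw [h a b, h b a, h a a, h b b, inner_self_eq_norm_sq (𝕜 := ℂ), inner_self_eq_norm_sq (𝕜 := ℂ),
    inner_re_symm (𝕜 := ℂ) (averagedFeature ν m B b)]
  linarith

open ENNReal in
-- By Tonelli the Gaussian integral may be taken first, and for each `U`, `V` it is the same by
-- unitary invariance.
theorem lintegral_unitaryAverage (m : ℕ) (a b : Ket d) :
    ∫⁻ G, ENNReal.ofReal (unitaryAverage ν m a b (truncate d d G))
      ∂(Measure.pi fun _ : Fin n => gaussianArray) = overlapMoment m a b := by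
  have hnn (U V : LocalUnitaries d) (M : (l : Fin n) → Matrix (Fin (d l)) (Fin (d l)) ℂ) :
      ENNReal.ofReal (‖amplitude (U.act a) (V.act b) M‖ ^ (2 * m)) =
        ‖amplitude (U.act a) (V.act b) M‖ₑ ^ (2 * m) := by
    rw [ENNReal.ofReal_pow (norm_nonneg _), ofReal_norm]
  have h1 (M : (l : Fin n) → Matrix (Fin (d l)) (Fin (d l)) ℂ) :
      ENNReal.ofReal (unitaryAverage ν m a b M) =
        ∫⁻ U, ∫⁻ V, ‖amplitude (U.act a) (V.act b) M‖ₑ ^ (2 * m) ∂ν ∂ν := by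
    rw [unitaryAverage, ofReal_integral_eq_lintegral_ofReal]
    · refine lintegral_congr fun U => ?_
      rw [ofReal_integral_eq_lintegral_ofReal]
      · simp_rw [hnn]
      · exact (Continuous.norm_amplitude_act_pow (by fun_prop) (by fun_prop) (by fun_prop)
          m a b).integrable_of_compactSpace
      · exact Filter.Eventually.of_forall fun _ => by positivity
    · exact ((continuous_integral_norm_amplitude_act_pow ν m a b).comp
        (by fun_prop : Continuous fun U => (M, U))).integrable_of_compactSpace
    · exact Filter.Eventually.of_forall fun _ => integral_nonneg fun _ => by positivity
  simp_rw [h1]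
  have hmeas : Measurable fun p : ((Fin n → ℕ × ℕ → ℂ) × LocalUnitaries d) × LocalUnitaries d =>
      ‖amplitude (p.1.2.act a) (p.2.act b) (truncate d d p.1.1)‖ₑ ^ (2 * m) := by
    have : Continuous fun p : ((Fin n → ℕ × ℕ → ℂ) × LocalUnitaries d) × LocalUnitaries d =>
        ‖amplitude (p.1.2.act a) (p.2.act b) (truncate d d p.1.1)‖ ^ (2 * m) :=
      Continuous.norm_amplitude_act_pow (by fun_prop) (by fun_prop)
        ((continuous_truncate d d).comp (by fun_prop)) m a b
    simpa only [hnn] using this.measurable.ennreal_ofReal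
  rw [lintegral_lintegral_swap (Measurable.lintegral_prod_right' hmeas).aemeasurable]
  have h2 (U : LocalUnitaries d) : ∫⁻ G, ∫⁻ V, ‖amplitude (U.act a) (V.act b)
      (truncate d d G)‖ₑ ^ (2 * m) ∂ν ∂(Measure.pi fun _ : Fin n => gaussianArray) =
      overlapMoment m a b := by
    rw [lintegral_lintegral_swap]
    · have h3 (V : LocalUnitaries d) : ∫⁻ G, ‖amplitude (U.act a) (V.act b)
          (truncate d d G)‖ₑ ^ (2 * m) ∂(Measure.pi fun _ : Fin n => gaussianArray) =
          overlapMoment m a b :=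
        overlapMoment_tensorApply m U.conjTranspose_mul_self V.conjTranspose_mul_self a b
      simp_rw [h3]
      simp
    · exact (hmeas.comp (by fun_prop :
        Measurable fun p : (Fin n → ℕ × ℕ → ℂ) × LocalUnitaries d => ((p.1, U), p.2))).aemeasurable
  simp_rw [h2]
  simp

theorem unitaryAverage_add_eq [ν.IsMulLeftInvariant] (m : ℕ) {a b : Ket d}
    (ha : overlapMoment m a a = overlapMoment m a b)
    (hb : overlapMoment m b a = overlapMoment m b b)
    (M : (l : Fin n) → Matrix (Fin (d l)) (Fin (d l)) ℂ) :
    unitaryAverage ν m a b M + unitaryAverage ν m b a M =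
      unitaryAverage ν m a a M + unitaryAverage ν m b b M := by
  have hcont (x y : Ket d) : Continuous fun G => unitaryAverage ν m x y (truncate d d G) :=
    (continuous_unitaryAverage ν m x y).comp (continuous_truncate d d)
  have hmeas (x y : Ket d) :
      Measurable fun G => ENNReal.ofReal (unitaryAverage ν m x y (truncate d d G)) :=
    (hcont x y).measurable.ennreal_ofReal
  have hint (x y : Ket d) : ∫⁻ G, (ENNReal.ofReal (unitaryAverage ν m x y (truncate d d G)) +
      ENNReal.ofReal (unitaryAverage ν m y x (truncate d d G)))
      ∂(Measure.pi fun _ : Fin n => gaussianArray) = overlapMoment m x y + overlapMoment m y x := by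
    rw [lintegral_add_left (hmeas x y), lintegral_unitaryAverage, lintegral_unitaryAverage]
  have hint' : ∫⁻ G, (ENNReal.ofReal (unitaryAverage ν m a a (truncate d d G)) +
      ENNReal.ofReal (unitaryAverage ν m b b (truncate d d G)))
      ∂(Measure.pi fun _ : Fin n => gaussianArray) = overlapMoment m a a + overlapMoment m b b := by
    rw [lintegral_add_left (hmeas a a), lintegral_unitaryAverage, lintegral_unitaryAverage]
  -- A pointwise inequality between functions with equal finite integrals is an equality almost
  -- everywhere; `eq_zero_of_ae_truncate` then removes the exceptional set.
  have hae := ae_eq_of_ae_le_of_lintegral_le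
    (μ := Measure.pi fun _ : Fin n => gaussianArray)
    (f := fun G => ENNReal.ofReal (unitaryAverage ν m a b (truncate d d G)) +
      ENNReal.ofReal (unitaryAverage ν m b a (truncate d d G)))
    (g := fun G => ENNReal.ofReal (unitaryAverage ν m a a (truncate d d G)) +
      ENNReal.ofReal (unitaryAverage ν m b b (truncate d d G)))
    (Filter.Eventually.of_forall fun G => by
      simp only [← ENNReal.ofReal_add (unitaryAverage_nonneg ν m _ _ _)
        (unitaryAverage_nonneg ν m _ _ _)]
      exact ENNReal.ofReal_le_ofReal (unitaryAverage_add_le ν m a b _))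
    (by
      rw [hint]
      exact ENNReal.add_ne_top.2 ⟨overlapMoment_ne_top m a b, overlapMoment_ne_top m b a⟩)
    ((hmeas a a).add (hmeas b b)).aemeasurable
    (by rw [hint, hint', ha, hb])
  have h0 := eq_zero_of_ae_truncate (d := d)
    (D := fun M => (unitaryAverage ν m a b M + unitaryAverage ν m b a M) -
      (unitaryAverage ν m a a M + unitaryAverage ν m b b M))
    (((continuous_unitaryAverage ν m a b).add (continuous_unitaryAverage ν m b a)).sub
      ((continuous_unitaryAverage ν m a a).add (continuous_unitaryAverage ν m b b)))
    (hae.mono fun G hG => by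
      simp only [← ENNReal.ofReal_add (unitaryAverage_nonneg ν m _ _ _)
        (unitaryAverage_nonneg ν m _ _ _)] at hG
      rw [ENNReal.ofReal_eq_ofReal_iff (add_nonneg (unitaryAverage_nonneg ν m _ _ _)
        (unitaryAverage_nonneg ν m _ _ _)) (add_nonneg (unitaryAverage_nonneg ν m _ _ _)
        (unitaryAverage_nonneg ν m _ _ _))] at hG
      exact sub_eq_zero.2 hG) M
  exact sub_eq_zero.1 h0

end

/-! ### Asymptotics in `m` at the identity, and the theorem. -/

noncomputable section

open MeasureTheory

variable {n : ℕ} {d : Fin n → ℕ}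

theorem amplitude_one (a b : Ket d) : amplitude a b (fun _ => 1) = inner ℂ a b := by
  rw [amplitude_apply, tensorApply_one]

theorem continuous_norm_inner_act {X : Type*} [TopologicalSpace X] {U V : X → LocalUnitaries d}
    (hU : Continuous U) (hV : Continuous V) (a b : Ket d) :
    Continuous fun x => ‖(inner ℂ ((U x).act a) ((V x).act b) : ℂ)‖ :=
  ((hU.act continuous_const).inner (hV.act continuous_const)).norm

/-- By compactness the largest overlap is attained. If it were `1`, equality in Cauchy-Schwarz would
make the two vectors differ by a phase, hence be equivalent. -/
theorem exists_norm_inner_act_le [NeZero n] {ψ φ : Ket d} (hψ : IsState ψ) (hφ : IsState φ)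
    (h : ¬ LocalUnitaryEquivalent ψ φ) :
    ∃ c : ℝ, 0 ≤ c ∧ c < 1 ∧
      ∀ U V : LocalUnitaries d, ‖(inner ℂ (U.act ψ) (V.act φ) : ℂ)‖ ≤ c := by
  have hcont : Continuous fun p : LocalUnitaries d × LocalUnitaries d =>
      ‖(inner ℂ (p.1.act ψ) (p.2.act φ) : ℂ)‖ :=
    continuous_norm_inner_act continuous_fst continuous_snd _ _
  obtain ⟨⟨U, V⟩, -, hmax⟩ := isCompact_univ.exists_isMaxOn Set.univ_nonempty hcont.continuousOn
  have hU : ‖U.act ψ‖ = 1 := (U.norm_act ψ).trans hψ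
  have hV : ‖V.act φ‖ = 1 := (V.norm_act φ).trans hφ
  have hmax' (U' V' : LocalUnitaries d) : ‖(inner ℂ (U'.act ψ) (V'.act φ) : ℂ)‖ ≤
      ‖(inner ℂ (U.act ψ) (V.act φ) : ℂ)‖ := isMaxOn_iff.1 hmax (U', V') (Set.mem_univ _)
  have hle : ‖(inner ℂ (U.act ψ) (V.act φ) : ℂ)‖ ≤ 1 := by
    refine (norm_inner_le_norm _ _).trans ?_
    rw [hU, hV, mul_one]
  refine ⟨‖(inner ℂ (U.act ψ) (V.act φ) : ℂ)‖, norm_nonneg _, lt_of_le_of_ne hle fun heq => h ?_,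
    hmax'⟩
  have hU0 : U.act ψ ≠ 0 := norm_ne_zero_iff.1 (by rw [hU]; exact one_ne_zero)
  have hV0 : V.act φ ≠ 0 := norm_ne_zero_iff.1 (by rw [hV]; exact one_ne_zero)
  obtain ⟨r, -, hr⟩ := (norm_inner_eq_norm_iff (𝕜 := ℂ) hU0 hV0).1 (by rw [heq, hU, hV, mul_one])
  have hr1 : ‖r‖ = 1 := by
    rw [hr, norm_smul, hU, mul_one] at hV
    exact hV
  have h1 := (U.localUnitaryEquivalent_act ψ).trans (localUnitaryEquivalent_smul hr1 (U.act ψ))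
  rw [← hr] at h1
  exact h1.trans (V.localUnitaryEquivalent_act φ).symm

section Average

variable [MeasurableSpace (LocalUnitaries d)] (ν : Measure (LocalUnitaries d))

theorem unitaryAverage_one (m : ℕ) (a b : Ket d) :
    unitaryAverage ν m a b (fun _ => 1) = ∫ U : LocalUnitaries d, ∫ V : LocalUnitaries d,
      ‖(inner ℂ (U.act a) (V.act b) : ℂ)‖ ^ (2 * m) ∂ν ∂ν := by
  simp_rw [unitaryAverage, amplitude_one]

variable [BorelSpace (LocalUnitaries d)] [IsProbabilityMeasure ν]

theorem integrable_norm_inner_act_pow (m : ℕ) (a b : Ket d) (U : LocalUnitaries d) :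
    Integrable (fun V : LocalUnitaries d =>
      ‖(inner ℂ (U.act a) (V.act b) : ℂ)‖ ^ (2 * m)) ν :=
  Continuous.integrable_of_compactSpace
    ((continuous_norm_inner_act continuous_const continuous_id a b).pow _)

theorem integrable_integral_norm_inner_act_pow (m : ℕ) (a b : Ket d) :
    Integrable (fun U : LocalUnitaries d => ∫ V : LocalUnitaries d,
      ‖(inner ℂ (U.act a) (V.act b) : ℂ)‖ ^ (2 * m) ∂ν) ν := by
  have h := (continuous_integral_norm_amplitude_act_pow ν m a b).comp
    (Continuous.prodMk_right (Y := LocalUnitaries d)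
      fun l => (1 : Matrix (Fin (d l)) (Fin (d l)) ℂ))
  simp only [Function.comp_def, amplitude_one] at h
  exact h.integrable_of_compactSpace

theorem unitaryAverage_one_le {c : ℝ} (m : ℕ) {a b : Ket d}
    (h : ∀ U V : LocalUnitaries d, ‖(inner ℂ (U.act a) (V.act b) : ℂ)‖ ≤ c) :
    unitaryAverage ν m a b (fun _ => 1) ≤ c ^ (2 * m) := by
  rw [unitaryAverage_one]
  calc _ ≤ ∫ _ : LocalUnitaries d, ∫ _ : LocalUnitaries d, c ^ (2 * m) ∂ν ∂ν := by
        refine integral_mono (integrable_integral_norm_inner_act_pow ν m a b)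
          (integrable_const _) fun U => integral_mono
            (integrable_norm_inner_act_pow ν m a b U) (integrable_const _) fun V => ?_
        exact pow_le_pow_left₀ (norm_nonneg _) (h U V) _
    _ = c ^ (2 * m) := by simp

/-- The overlap is `1` at `U = V = 1`, so it exceeds `t` on a product of open neighbourhoods; `τ` is
the measure of that product and does not depend on `m`. -/
theorem exists_mul_pow_le_unitaryAverage_one [ν.IsOpenPosMeasure] {ψ : Ket d} (hψ : IsState ψ)
    {t : ℝ} (ht0 : 0 ≤ t) (ht : t < 1) :
    ∃ τ : ℝ, 0 < τ ∧ ∀ m, τ * t ^ (2 * m) ≤ unitaryAverage ν m ψ ψ (fun _ => 1) := by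
  have hcont : Continuous fun p : LocalUnitaries d × LocalUnitaries d =>
      ‖(inner ℂ (p.1.act ψ) (p.2.act ψ) : ℂ)‖ :=
    continuous_norm_inner_act continuous_fst continuous_snd _ _
  have hopen : IsOpen {p : LocalUnitaries d × LocalUnitaries d |
      t < ‖(inner ℂ (p.1.act ψ) (p.2.act ψ) : ℂ)‖} := isOpen_lt continuous_const hcont
  have hone : t < ‖(inner ℂ ((1 : LocalUnitaries d).act ψ) ((1 : LocalUnitaries d).act ψ) : ℂ)‖ := by
    rw [LocalUnitaries.one_act, inner_self_eq_norm_sq_to_K, show ‖ψ‖ = 1 from hψ]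
    simpa using ht
  obtain ⟨O₁, O₂, hO₁, hO₂, h1, h2, hsub⟩ := isOpen_prod_iff.1 hopen 1 1 hone
  have hpos (O : Set (LocalUnitaries d)) (hO : IsOpen O) (h : 1 ∈ O) : 0 < ν.real O :=
    ENNReal.toReal_pos (hO.measure_pos ν ⟨1, h⟩).ne' (measure_ne_top ν O)
  refine ⟨ν.real O₁ * ν.real O₂, mul_pos (hpos O₁ hO₁ h1) (hpos O₂ hO₂ h2), fun m => ?_⟩
  rw [unitaryAverage_one]
  have hind (s : ℝ) {O : Set (LocalUnitaries d)} (hO : IsOpen O) :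
      Integrable (O.indicator fun _ => s) ν :=
    (integrable_const s).indicator hO.measurableSet
  calc ν.real O₁ * ν.real O₂ * t ^ (2 * m)
      = ∫ U, O₁.indicator (fun _ => ν.real O₂ * t ^ (2 * m)) U ∂ν := by
        rw [integral_indicator_const _ hO₁.measurableSet, smul_eq_mul, mul_assoc]
    _ ≤ _ := by
        refine integral_mono (hind _ hO₁) (integrable_integral_norm_inner_act_pow ν m ψ ψ) fun U => ?_
        by_cases hU : U ∈ O₁
        · rw [Set.indicator_of_mem hU, ← smul_eq_mul,
            ← integral_indicator_const _ hO₂.measurableSet]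
          refine integral_mono (hind _ hO₂) (integrable_norm_inner_act_pow ν m ψ ψ U) fun V => ?_
          by_cases hV : V ∈ O₂
          · rw [Set.indicator_of_mem hV]
            exact pow_le_pow_left₀ ht0 (hsub (Set.mk_mem_prod hU hV)).le _
          · rw [Set.indicator_of_notMem hV]
            positivity
        · rw [Set.indicator_of_notMem hU]
          exact integral_nonneg fun _ => by positivity

end Average

theorem localUnitaryEquivalent_of_overlapMoment_eq [NeZero n] {ψ φ : Ket d} (hψ : IsState ψ)
    (hφ : IsState φ) (h1 : ∀ m, overlapMoment m ψ ψ = overlapMoment m ψ φ)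
    (h2 : ∀ m, overlapMoment m φ ψ = overlapMoment m φ φ) : LocalUnitaryEquivalent ψ φ := by
  by_contra hne
  let _ : MeasurableSpace (LocalUnitaries d) := borel _
  have : BorelSpace (LocalUnitaries d) := ⟨rfl⟩
  let ν : Measure (LocalUnitaries d) := Measure.haarMeasure ⊤
  have : IsProbabilityMeasure ν := ⟨Measure.haarMeasure_self⟩
  obtain ⟨c, hc0, hc1, hc⟩ := exists_norm_inner_act_le hψ hφ hne
  have hc' (U V : LocalUnitaries d) : ‖(inner ℂ (U.act φ) (V.act ψ) : ℂ)‖ ≤ c := by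
    rw [norm_inner_symm]
    exact hc V U
  obtain ⟨t, hct, ht1⟩ := exists_between hc1
  have ht0 : 0 < t := hc0.trans_lt hct
  obtain ⟨τ, hτ, hle⟩ := exists_mul_pow_le_unitaryAverage_one ν hψ ht0.le ht1
  -- Choosing `(c/t)^(2m) < τ/2` makes the two cross terms together, at most `2 c^(2m)`, smaller
  -- than `τ t^(2m)`.
  obtain ⟨m, hm⟩ := exists_pow_lt_of_lt_one (half_pos hτ)
    (pow_lt_one₀ (div_nonneg hc0 ht0.le) ((div_lt_one ht0).2 hct) two_ne_zero)
  rw [← pow_mul, div_pow, div_lt_iff₀ (by positivity)] at hm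
  have e := unitaryAverage_add_eq ν m (h1 m) (h2 m) fun _ => 1
  have e1 := unitaryAverage_one_le ν m hc
  have e2 := unitaryAverage_one_le ν m hc'
  have e3 := hle m
  have e4 := unitaryAverage_nonneg ν m φ φ fun _ => 1
  linarith

theorem theorem1 (n : ℕ) (hn : 1 ≤ n) (d : Fin n → ℕ) (ψ φ : Ket d)
    (hψ : IsState ψ) (hφ : IsState φ) :
    (∀ E : (d : Fin n → ℕ) → Ket d → ℝ, IsEntanglementMonotone E → E d ψ = E d φ) ↔
      LocalUnitaryEquivalent ψ φ := by
  have : NeZero n := ⟨by omega⟩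
  refine ⟨fun h => ?_, fun h E hE => hE.eq_of_localUnitaryEquivalent hψ hφ h⟩
  have hM (m : ℕ) (Ψ : Ket d) : overlapMonotone m Ψ d ψ = overlapMonotone m Ψ d φ :=
    h _ (isEntanglementMonotone_overlapMonotone m Ψ)
  by_cases hψp : IsProductKet ψ
  · by_cases hφp : IsProductKet φ
    · exact hψp.localUnitaryEquivalent hφp hψ hφ
    -- Any exponent and reference vector would do: the monotone is `0` on product states and at
    -- least `1` on all other states.
    · have h1 := one_le_overlapMonotone 0 ψ hφ hφp
      rw [← hM 0 ψ, overlapMonotone, if_pos hψp] at h1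
      exact absurd h1 (by norm_num)
  · by_cases hφp : IsProductKet φ
    · have h1 := one_le_overlapMonotone 0 ψ hψ hψp
      rw [hM 0 ψ, overlapMonotone, if_pos hφp] at h1
      exact absurd h1 (by norm_num)
    · have hK (m : ℕ) (Ψ : Ket d) : overlapMoment m Ψ ψ = overlapMoment m Ψ φ := by
        have h1 := hM m Ψ
        rw [overlapMonotone, overlapMonotone, if_neg hψp, if_neg hφp] at h1
        exact (ENNReal.toReal_eq_toReal_iff' (overlapMoment_ne_top m Ψ ψ)
          (overlapMoment_ne_top m Ψ φ)).1 (by linarith)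
      exact localUnitaryEquivalent_of_overlapMoment_eq hψ hφ (fun m => hK m ψ) (fun m => hK m φ)

end
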